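/- **Setting.** A private-coin shuffle protocol consists of a randomiser $\mathcal R\colon\mathcal X\to\mathcal Y^*$ and an analyser $\mathcal A$; $\mathcal S\circ\mathcal R^m$ denotes the uniformly permuted concatenation of the messages of $m$ users. A protocol for $n$ users is $(\varepsilon,\delta',\gamma)$-*robustly shuffle private* if $\mathcal S\circ\mathcal R^m$ is $(\varepsilon,\delta')$-differentially private (for datasets at Hamming distance at most one) for every integer $m$ with $\gamma n\le m\le n$. It *solves $\alpha$-uniformity testing* with $n$ users if, when the users hold $n$ i.i.d. samples from a distribution $\mathbf p$ on $[k]$, it accepts with probability at least $2/3$ when $\mathbf p=\mathbf U_k$ is uniform, and rejects with probability at least $2/3$ when $d_{TV}(\mathbf p,\mathbf U_k)>\alpha$. **The protocol.** For $k\ge 2$ and $\varepsilon_L>0$ let $a=2^{\lfloor\log_2\min(e^{\varepsilon_L},2k)\rfloor}$, $b=2^{\lceil\log_2(k/a+1)\rceil}$, $K=ab$ and $s=b/2$. Let $\bar H$ be the $K\times K$ block matrix with $a\times a$ blocks whose diagonal blocks are Sylvester's $b\times b$ Hadamard matrix and whose off-diagonal blocks have all entries $-1$. Assign to the elements $x\in[k]$,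 in order, distinct rows of $\bar H$ other than the first row of each block row, and let $C_x\subseteq[K]$ be the set of positions of the entries $+1$ of the row of $x$ (so $|C_x|=s$). The randomiser $\mathcal R_{\rm ldp}$ sends the single message $y\in[K]$ with probability $$\Pr[\mathcal R_{\rm ldp}(x)=y]=\frac{(e^{\varepsilon_L}-1)\mathbf 1\{y\in C_x\}+1}{s e^{\varepsilon_L}+K-s}.$$ The analyser $\mathcal A_{\rm ldp}$ computes the distribution $\mathbf q^*$ of $\mathcal R_{\rm ldp}(x)$ for $x\sim\mathbf U_k$ and $\tau^2=\frac{2\alpha^2}{sk}\Big(\frac{e^{\varepsilon_L}-1}{e^{\varepsilon_L}+K/s-1}\Big)^2$; given $n$ messages, it draws $n$ independent samples from $\mathbf q^*$ and accepts if and only if $\sum_{j\in[K]}\big((X_j-Y_j)^2-X_j-Y_j\big)\le n^2\tau^2/2$, where $X_j$ and $Y_j$ count the occurrences of $j$ among the messages and among the drawn samples. **Theorem.** There is an absolute constant $C>0$ such that the following holds for all integers $k\ge2$, $n\ge1$ and all $\varepsilon\in(0,1]$, $\alpha,\delta\in(0,1)$. There is a unique $\varepsilon_L>0$ with $$\varepsilon=\log\Big(1+16e^{\varepsilon_L/2}\cdot\frac{e^{\varepsilon_L}-1}{e^{\varepsilon_L}+1}\sqrt{\frac{\log(4/\delta)}{n}}\Big),$$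 and the shuffle protocol $\mathcal P=(\mathcal R_{\rm ldp},\mathcal A_{\rm ldp})$ for $n$ users with this $\varepsilon_L$ satisfies: 1. $\mathcal P$ is $(\varepsilon,4\delta^\gamma,\gamma)$-robustly shuffle private for every $\gamma\in(0,1]$; 2. $\mathcal P$ solves $\alpha$-uniformity testing with $n$ users whenever $$n\ge C\Big(\frac{k^{3/4}}{\alpha\varepsilon}\sqrt{\log(4/\delta)}+\frac{\sqrt k}{\alpha^2}\Big);$$ 3. each user sends exactly one message, of at most $\log_2k+4$ bits. (For $\delta\le 1/2$, $\log(4/\delta)$ may be replaced by $\log(1/\delta)$ in 2, up to the value of $C$.) -/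

import Mathlib

noncomputable section

/-! ### Discrete probability -/

/-- The probability of the event `S` under the discrete distribution `p`. -/
def prob {A : Type} (p : PMF A) (S : Set A) : ℝ := (p.toOuterMeasure S).toReal

/-- The law of `n` i.i.d. samples from `p`. -/
def iidSample {A : Type} (p : PMF A) : (n : ℕ) → PMF (Fin n → A)
  | 0 => PMF.pure Fin.elim0
  | n + 1 => p.bind fun a => (iidSample p n).map fun v => (Fin.cons a v : Fin (n + 1) → A)

/-- Total variation distance `sup_S (p(S) - q(S))`. -/
def tvDist {A : Type} (p q : PMF A) : ℝ := ⨆ S : Set A, (prob p S - prob q S)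

/-! ### Differential privacy and shuffle protocols -/

/-- `(ε, δ)`-differential privacy of a randomised algorithm on `n`-element datasets; datasets are
adjacent when their Hamming distance is at most one. -/
def IsDP {X Z : Type} [DecidableEq X] {n : ℕ} (M : (Fin n → X) → PMF Z) (ε δ : ℝ) : Prop :=
  ∀ x x' : Fin n → X, hammingDist x x' ≤ 1 →
    ∀ S : Set Z, prob (M x) S ≤ Real.exp ε * prob (M x') S + δ

/-- A private-coin (non-interactive) shuffle protocol: a randomiser mapping a data point to a tuple
of messages, and an analyser of the shuffled tuple of all messages. -/
structure ShuffleProtocol (X Y Z : Type) where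
  randomiser : X → PMF (List Y)
  analyser : List Y → PMF Z

/-- A uniformly random permutation of a tuple. -/
def shuffle {Y : Type} (l : List Y) : PMF (List Y) :=
  (PMF.uniformOfFintype (Equiv.Perm (Fin l.length))).map fun σ => List.ofFn fun i => l.get (σ i)

/-- Concatenation of the tuples produced by independent runs of `R` on `x 0, …, x (n-1)`. -/
def concatMessages {X Y : Type} (R : X → PMF (List Y)) : (n : ℕ) → (Fin n → X) → PMF (List Y)
  | 0, _ => PMF.pure []
  | n + 1, x => (R (x 0)).bind fun l => (concatMessages R n (Fin.tail x)).map fun l' => l ++ l'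

namespace ShuffleProtocol

variable {X Y Z : Type}

/-- The output `S ∘ R^n` of the shuffler for `n` users. -/
def shuffled (P : ShuffleProtocol X Y Z) (n : ℕ) (x : Fin n → X) : PMF (List Y) :=
  (concatMessages P.randomiser n x).bind shuffle

/-- The output of the protocol with `n` users on the dataset `x`. -/
def run (P : ShuffleProtocol X Y Z) (n : ℕ) (x : Fin n → X) : PMF Z :=
  (P.shuffled n x).bind P.analyser

/-- The protocol `P`, designed for `n` users, is `(ε, δ, γ)`-robustly shuffle private: the shuffled
messages of the honest users are `(ε, δ)`-DP whenever at least a fraction `γ` of the `n` users is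
honest, i.e. whenever there are `m` honest users with `γ n ≤ m ≤ n`. -/
def IsRobustlyShufflePrivate [DecidableEq X] (P : ShuffleProtocol X Y Z) (n : ℕ)
    (ε δ γ : ℝ) : Prop :=
  ∀ m : ℕ, m ≤ n → γ * n ≤ m → IsDP (P.shuffled m) ε δ

/-- Every user sends exactly one message, which can be encoded with `l` bits. -/
def SendsOneMessage [Fintype Y] (P : ShuffleProtocol X Y Z) (l : ℕ) : Prop :=
  (∀ x, ∀ t ∈ (P.randomiser x).support, t.length = 1) ∧ Fintype.card Y ≤ 2 ^ l

/-- The protocol with `n` users, each holding one i.i.d. sample from an unknown distribution over a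
domain of size `k`, solves `α`-uniformity testing (`true` is "accept", `false` is "reject"). -/
def SolvesUniformityTesting {k : ℕ} [NeZero k] (P : ShuffleProtocol (Fin k) Y Bool) (n : ℕ)
    (α : ℝ) : Prop :=
  2 / 3 ≤ prob ((iidSample (PMF.uniformOfFintype (Fin k)) n).bind (P.run n)) {true} ∧
  ∀ p : PMF (Fin k), α < tvDist p (PMF.uniformOfFintype (Fin k)) →
    2 / 3 ≤ prob ((iidSample p n).bind (P.run n)) {false}

end ShuffleProtocol

/-! ### Hadamard matrices -/

/-- Sylvester's Hadamard matrix of order `2 ^ t`, with blocks `H, H; H, -H`. -/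
def sylvester : (t : ℕ) → Matrix (Fin (2 ^ t)) (Fin (2 ^ t)) ℤ
  | 0 => fun _ _ => 1
  | t + 1 =>
    let e : Fin 2 × Fin (2 ^ t) ≃ Fin (2 ^ (t + 1)) :=
      finProdFinEquiv.trans (finCongr (pow_succ' 2 t).symm)
    Matrix.reindex e e (Matrix.kroneckerMap (· * ·) !![1, 1; 1, -1] (sylvester t))

theorem sylvester_eq_or (t : ℕ) (i j : Fin (2 ^ t)) :
    sylvester t i j = 1 ∨ sylvester t i j = -1 := by
  induction t with
  | zero => left; rfl
  | succ t ih =>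
    simp only [sylvester, Matrix.reindex_apply, Matrix.submatrix_apply, Matrix.kroneckerMap_apply]
    generalize ((finProdFinEquiv.trans (finCongr (pow_succ' 2 t).symm)).symm i) = p
    generalize ((finProdFinEquiv.trans (finCongr (pow_succ' 2 t).symm)).symm j) = q
    obtain ⟨p0, p1⟩ := p
    obtain ⟨q0, q1⟩ := q
    fin_cases p0 <;> fin_cases q0 <;> rcases ih p1 q1 with h | h <;> simp [h]

theorem sylvester_row_sum (t : ℕ) (i : Fin (2 ^ t)) (hi : (i : ℕ) ≠ 0) :
    ∑ j, sylvester t i j = 0 := by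
  induction t with
  | zero => exact absurd (by have := i.isLt; simp) hi
  | succ t ih =>
    simp only [sylvester, Matrix.reindex_apply, Matrix.submatrix_apply, Matrix.kroneckerMap_apply]
    set e : Fin 2 × Fin (2 ^ t) ≃ Fin (2 ^ (t + 1)) :=
      finProdFinEquiv.trans (finCongr (pow_succ' 2 t).symm) with he
    obtain ⟨⟨p0, p1⟩, rfl⟩ := e.surjective i
    rw [← e.sum_comp]
    simp only [Equiv.symm_apply_apply, Fintype.sum_prod_type]
    simp only [← Finset.mul_sum]
    by_cases h1 : (p1 : ℕ) = 0
    · have h0 : p0 = 1 := by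
        have hv : ((e (p0, p1) : Fin (2 ^ (t + 1))) : ℕ) = p1 + 2 ^ t * p0 := by simp [he]
        rw [hv, h1] at hi
        fin_cases p0
        · simp at hi
        · rfl
      subst h0
      simp
    · simp [ih p1 h1]

/-- The `(a, 2 ^ t)`-reduced Hadamard matrix: an `a × a` array of blocks, with the Hadamard matrix
of order `2 ^ t` in the diagonal blocks and all entries `-1` in the other blocks. Rows and columns
are indexed by the block and the position within the block. -/
def reducedHadamard (a t : ℕ) : Matrix (Fin a × Fin (2 ^ t)) (Fin a × Fin (2 ^ t)) ℤ :=
  fun r c => if r.1 = c.1 then sylvester t r.2 c.2 else -1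

/-! ### Generalised Hadamard Response -/

/-- `a = 2 ^ ⌊log₂ min(e^ε, 2k)⌋`. -/
def ghrA (k : ℕ) (ε : ℝ) : ℕ := 2 ^ ⌊Real.logb 2 (min (Real.exp ε) (2 * k))⌋₊

/-- The exponent `⌈log₂ (k / a + 1)⌉` of `b`. -/
def ghrT (k : ℕ) (ε : ℝ) : ℕ := ⌈Real.logb 2 ((k : ℝ) / ghrA k ε + 1)⌉₊

/-- `b = 2 ^ ⌈log₂ (k / a + 1)⌉`. -/
def ghrB (k : ℕ) (ε : ℝ) : ℕ := 2 ^ ghrT k ε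

/-- The size `K = a b` of the message alphabet. -/
def ghrK (k : ℕ) (ε : ℝ) : ℕ := ghrA k ε * ghrB k ε

/-- `s = b / 2`. -/
def ghrS (k : ℕ) (ε : ℝ) : ℕ := ghrB k ε / 2

/-- The message alphabet `[K]`, with `K = a b`, written as `[a] × [b]`. -/
abbrev GHRMessage (k : ℕ) (ε : ℝ) : Type := Fin (ghrA k ε) × Fin (2 ^ ghrT k ε)

theorem ghr_le (k : ℕ) (ε : ℝ) : k ≤ ghrA k ε * (2 ^ ghrT k ε - 1) := by
  have ha : (0 : ℝ) < ghrA k ε := by unfold ghrA; positivity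
  have hx : (0 : ℝ) < (k : ℝ) / ghrA k ε + 1 := by positivity
  have h1 : (k : ℝ) / ghrA k ε + 1 ≤ (2 : ℝ) ^ ghrT k ε := by
    have h := Nat.le_ceil (Real.logb 2 ((k : ℝ) / ghrA k ε + 1))
    rw [Real.logb_le_iff_le_rpow (by norm_num) hx, Real.rpow_natCast] at h
    exact h
  have h2 : (k : ℝ) ≤ ghrA k ε * ((2 : ℝ) ^ ghrT k ε - 1) := by
    have h3 : (k : ℝ) / ghrA k ε ≤ (2 : ℝ) ^ ghrT k ε - 1 := by linarith
    rw [div_le_iff₀ ha] at h3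
    linarith
  have h4 : 1 ≤ 2 ^ ghrT k ε := Nat.one_le_two_pow
  have h5 : (k : ℝ) ≤ ((ghrA k ε * (2 ^ ghrT k ε - 1) : ℕ) : ℝ) := by
    push_cast [Nat.cast_sub h4]
    exact h2
  exact_mod_cast h5

theorem ghr_one_lt (k : ℕ) [NeZero k] (ε : ℝ) : 1 < 2 ^ ghrT k ε := by
  have h := ghr_le k ε
  have hk : 0 < k := Nat.pos_of_ne_zero (NeZero.ne k)
  by_contra h'
  have h0 : 2 ^ ghrT k ε - 1 = 0 := by omega
  rw [h0] at h
  omega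

/-- The row of the reduced Hadamard matrix assigned to `x`: the rows other than the first row of
each block row are assigned in order, `b - 1` of them in each of the `a` block rows. -/
def ghrRow (k : ℕ) [NeZero k] (ε : ℝ) (x : Fin k) : GHRMessage k ε :=
  (⟨x / (2 ^ ghrT k ε - 1), by
      have h := ghr_le k ε
      have hx := x.isLt
      exact Nat.div_lt_of_lt_mul (by rw [mul_comm]; omega)⟩,
   ⟨x % (2 ^ ghrT k ε - 1) + 1, by
      have h := ghr_one_lt k ε
      have := Nat.mod_lt (x : ℕ) (show 0 < 2 ^ ghrT k ε - 1 by omega)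
      omega⟩)

/-- `C_x`, the set whose indicator is the row assigned to `x`. -/
def ghrSet (k : ℕ) [NeZero k] (ε : ℝ) (x : Fin k) : Finset (GHRMessage k ε) :=
  Finset.univ.filter fun y => reducedHadamard (ghrA k ε) (ghrT k ε) (ghrRow k ε x) y = 1

theorem ghrSet_card (k : ℕ) [NeZero k] (ε : ℝ) (x : Fin k) :
    (ghrSet k ε x).card = ghrS k ε := by
  have hrow : ((ghrRow k ε x).2 : ℕ) ≠ 0 := by simp [ghrRow]
  generalize hr : ghrRow k ε x = r at hrow
  obtain ⟨i, u⟩ := r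
  have hset : ghrSet k ε x =
      {i} ×ˢ (Finset.univ.filter fun j => sylvester (ghrT k ε) u j = 1) := by
    ext ⟨i', j⟩
    simp only [ghrSet, hr, reducedHadamard, Finset.mem_filter, Finset.mem_univ, true_and,
      Finset.mem_product, Finset.mem_singleton]
    by_cases h : i = i'
    · subst h; simp
    · simp [h, Ne.symm h]
  rw [hset, Finset.card_product, Finset.card_singleton, one_mul]
  have hsum := sylvester_row_sum (ghrT k ε) u hrow
  have hval : ∀ j, sylvester (ghrT k ε) u j =
      2 * (if sylvester (ghrT k ε) u j = 1 then 1 else 0) - 1 := by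
    intro j
    rcases sylvester_eq_or (ghrT k ε) u j with h | h <;> simp [h]
  rw [Finset.sum_congr rfl fun j _ => hval j, Finset.sum_sub_distrib, ← Finset.mul_sum,
    Finset.sum_boole] at hsum
  simp only [Finset.sum_const, Finset.card_univ, Fintype.card_fin, nsmul_eq_mul, mul_one] at hsum
  have h2 : 2 * (Finset.univ.filter fun j => sylvester (ghrT k ε) u j = 1).card
      = 2 ^ ghrT k ε := by
    have : (2 * (Finset.univ.filter fun j => sylvester (ghrT k ε) u j = 1).card : ℤ)
      = ((2 ^ ghrT k ε : ℕ) : ℤ) := by linarith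
    exact_mod_cast this
  unfold ghrS ghrB
  omega

/-- The transition probabilities
`P(R(x) = y) = ((e^ε - 1) 1{y ∈ C_x} + 1) / (s e^ε + K - s)`. -/
def ghrProb (k : ℕ) [NeZero k] (ε : ℝ) (x : Fin k) (y : GHRMessage k ε) : ℝ :=
  ((Real.exp ε - 1) * (if y ∈ ghrSet k ε x then 1 else 0) + 1) /
    (ghrS k ε * Real.exp ε + ghrK k ε - ghrS k ε)

theorem ghrProb_sum (k : ℕ) [NeZero k] (ε : ℝ) (x : Fin k) :
    ∑ y, ENNReal.ofReal (ghrProb k ε x y) = 1 := by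
  have hs : 2 * ghrS k ε ≤ ghrK k ε := by
    have ha : 1 ≤ ghrA k ε := Nat.one_le_two_pow
    have h1 : 2 * ghrS k ε ≤ ghrB k ε := Nat.mul_div_le _ _
    exact h1.trans (Nat.le_mul_of_pos_left _ ha)
  have hs0 : 1 ≤ ghrS k ε := by
    have := ghr_one_lt k ε
    unfold ghrS ghrB
    omega
  have hsR : (2 : ℝ) * ghrS k ε ≤ ghrK k ε := by exact_mod_cast hs
  have hs0R : (1 : ℝ) ≤ ghrS k ε := by exact_mod_cast hs0
  have hden : 0 < ghrS k ε * Real.exp ε + ghrK k ε - ghrS k ε := by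
    have : 0 < (ghrS k ε : ℝ) * Real.exp ε := by positivity
    linarith
  have hnn : ∀ y, 0 ≤ ghrProb k ε x y := by
    intro y
    unfold ghrProb
    apply div_nonneg _ hden.le
    have := Real.exp_pos ε
    split_ifs <;> linarith
  rw [← ENNReal.ofReal_sum_of_nonneg fun y _ => hnn y, ← ENNReal.ofReal_one]
  congr 1
  unfold ghrProb
  rw [← Finset.sum_div, div_eq_one_iff_eq hden.ne', Finset.sum_add_distrib, ← Finset.mul_sum,
    Finset.sum_boole]
  have hc : (Finset.univ.filter fun y => y ∈ ghrSet k ε x).card = ghrS k ε := by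
    rw [← ghrSet_card k ε x]
    congr 1
    ext y
    simp
  rw [hc]
  simp only [Finset.sum_const, Finset.card_univ, Fintype.card_prod, Fintype.card_fin,
    nsmul_eq_mul, mul_one]
  simp only [ghrK, ghrB]
  push_cast
  ring

/-- The Generalised Hadamard Response mechanism. -/
def ghrMechanism (k : ℕ) [NeZero k] (ε : ℝ) (x : Fin k) : PMF (GHRMessage k ε) :=
  PMF.ofFintype (fun y => ENNReal.ofReal (ghrProb k ε x y)) (ghrProb_sum k ε x)

/-- The distribution `q* = Φ_ε(U_k)` of the message of a user holding a uniform sample. -/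
def ghrReference (k : ℕ) [NeZero k] (ε : ℝ) : PMF (GHRMessage k ε) :=
  (PMF.uniformOfFintype (Fin k)).bind (ghrMechanism k ε)

/-- The squared `ℓ₂` distance parameter
`γ² = (2 α² / (s k)) ((e^ε - 1) / (e^ε + K / s - 1))²` of the analyser. -/
def ghrGammaSq (k : ℕ) (ε α : ℝ) : ℝ :=
  2 * α ^ 2 / (ghrS k ε * k) *
    ((Real.exp ε - 1) / (Real.exp ε + (ghrK k ε : ℝ) / ghrS k ε - 1)) ^ 2

/-! ### The `ℓ₂` tester -/

/-- The statistic `∑_j ((X_j - Y_j)² - X_j - Y_j)`, where `X_j` and `Y_j` are the numbers of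
occurrences of `j` in `u` and in `v`. -/
def l2Statistic {Y : Type} [Fintype Y] [DecidableEq Y] (u v : List Y) : ℝ :=
  ∑ j, (((u.count j : ℝ) - v.count j) ^ 2 - u.count j - v.count j)

open Classical in
/-- The `ℓ₂` tester for a known reference distribution `q`: given `n` samples `u`, draw `n`
reference samples `v` from `q`, and accept if and only if the statistic is at most
`n² γ² / 2`, half-way between `0` and `n² γ²`. -/
def l2Tester {Y : Type} [Fintype Y] [DecidableEq Y] (q : PMF Y) (gammaSq : ℝ) (u : List Y) :
    PMF Bool :=
  (iidSample q u.length).map fun v =>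
    decide (l2Statistic u (List.ofFn v) ≤ (u.length : ℝ) ^ 2 * gammaSq / 2)

/-! ### The protocol -/

/-- The shuffle protocol whose users run the Generalised Hadamard Response mechanism with local
privacy parameter `εL`, each sending a single message, and whose analyser runs the `ℓ₂` tester. -/
def ghrProtocol (k : ℕ) [NeZero k] (εL α : ℝ) : ShuffleProtocol (Fin k) (GHRMessage k εL) Bool where
  randomiser x := (ghrMechanism k εL x).map fun y => [y]
  analyser := l2Tester (ghrReference k εL) (ghrGammaSq k εL α)

/-- `εL` is a positive solution of
`ε = log (1 + 16 e^(εL/2) ((e^εL - 1) / (e^εL + 1)) √(log (4/δ) / n))`. -/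
def IsLocalParameter (n : ℕ) (ε δ εL : ℝ) : Prop :=
  0 < εL ∧
  ε = Real.log (1 + 16 * Real.exp (εL / 2) * ((Real.exp εL - 1) / (Real.exp εL + 1)) *
    Real.sqrt (Real.log (4 / δ) / n))

end

/-! The proof has two independent halves, privacy and testing.

**Privacy.** The local parameter `εL` exists and is unique since `x ↦ e^(x/2) (e^x - 1) / (e^x + 1)`
increases strictly from `0` to `∞`. Write `u = e^εL`, `E = e^ε` and `L = log (4 / δ) / n`. When `m`
users are honest, privacy holds with the smaller failure probability `4 e^(-m L) ≤ 4 δ^γ`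
(`shuffle_amplification`). If `u L > 1 / 16`, the choice of `εL` forces `u ≤ E`, and local privacy
suffices. Otherwise the users hide among clones: the two candidate laws of the message of the
differing user are mixtures of two laws `Q₀`, `Q₁` with weights `u : 1` and `1 : u`, and every other
user draws from each of `Q₀`, `Q₁` with probability `1 / (2 u)` (`clones_hockeyStick`). Given which
users are clones, the shuffled output depends on the labels only through their number of each kind,
so the weight of the differing user may be averaged over all clones (`clone_average`). The averaged
likelihood ratio exceeds `E` only if the labels `Q₀` outnumber the labels `Q₁` by a fraction
`4 √(u L)` of the clones. The number of clones is random too, but this event says that a sum over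
all users of independent terms is positive, so one exponential moment bounds it (`clone_chernoff`);
no separate concentration of the number of clones is needed.

**Testing.** The tester ignores the order of the messages, so it compares `n` samples of `q`, the
law of a message, with `n` samples of the reference law `q*`. Pairing the samples writes its
statistic as `∑_{i ≠ j} ⟪D_i, D_j⟫ - 2 B` with i.i.d. vectors `D_i` of mean `q - q*` and `B` the number of
coincidences within the pairs (`l2Statistic_eq`). The Hoeffding decomposition, second moments of its
parts by induction on `n`, and Chebyshev's and Markov's inequalities show that the test succeeds if
`n τ²` is at least a large multiple of an upper bound on `‖q*‖`, where `τ²` is `ghrGammaSq`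
(`l2Tester_completeness`, `l2Tester_soundness`). The orthogonality of the rows of Sylvester's matrix
gives the intersections of the sets `C_x` (`sum_ghrInd_mul`); these yield
`‖q - q*‖² ≥ τ²` when the input is far from uniform (`ghr_separation`) and `‖q*‖² ≤ 5 / k`
(`norm_ghrReference_sq_le`). The sample size then suffices by `ghr_noise_le`, whose two terms match
the two terms of the assumed lower bound on `n`, the first by the
definition of `εL` (`exp_div_sq_le`). -/

noncomputable section

/-! ### Probabilities as finite sums -/

theorem prob_nonneg {A : Type} (p : PMF A) (S : Set A) : 0 ≤ prob p S := ENNReal.toReal_nonneg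

theorem toOuterMeasure_le_one {A : Type} (p : PMF A) (S : Set A) : p.toOuterMeasure S ≤ 1 := by
  rw [PMF.toOuterMeasure_apply, ← p.tsum_coe]
  exact ENNReal.tsum_le_tsum fun a => Set.indicator_le_self _ _ a

theorem prob_le_one {A : Type} (p : PMF A) (S : Set A) : prob p S ≤ 1 :=
  ENNReal.toReal_le_of_le_ofReal zero_le_one (by simpa using toOuterMeasure_le_one p S)

theorem prob_pure {A : Type} (a : A) (S : Set A) [Decidable (a ∈ S)] :
    prob (PMF.pure a) S = if a ∈ S then 1 else 0 := by
  unfold prob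
  rw [PMF.toOuterMeasure_pure_apply]
  split_ifs <;> simp

theorem prob_bind {A B : Type} [Fintype A] (p : PMF A) (g : A → PMF B) (S : Set B) :
    prob (p.bind g) S = ∑ a, (p a).toReal * prob (g a) S := by
  unfold prob
  rw [PMF.toOuterMeasure_bind_apply, tsum_fintype, ENNReal.toReal_sum]
  · simp [ENNReal.toReal_mul]
  · intro a _
    exact ENNReal.mul_ne_top (p.apply_ne_top a)
      ((toOuterMeasure_le_one _ _).trans_lt ENNReal.one_lt_top).ne

open Classical in
theorem prob_eq_sum {A : Type} [Fintype A] (p : PMF A) (S : Set A) :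
    prob p S = ∑ a, (p a).toReal * if a ∈ S then 1 else 0 := by
  conv_lhs => rw [← p.bind_pure]
  rw [prob_bind]
  exact Finset.sum_congr rfl fun a _ => by rw [prob_pure]

theorem sum_toReal_eq_one {A : Type} [Fintype A] (p : PMF A) : ∑ a, (p a).toReal = 1 := by
  rw [← ENNReal.toReal_sum fun a _ => p.apply_ne_top a, ← tsum_fintype (L := .unconditional _),
    p.tsum_coe, ENNReal.toReal_one]

theorem bind_toReal {A B : Type} [Fintype A] (p : PMF A) (g : A → PMF B) (b : B) :
    ((p.bind g) b).toReal = ∑ a, (p a).toReal * (g a b).toReal := by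
  rw [PMF.bind_apply, tsum_fintype, ENNReal.toReal_sum]
  · simp [ENNReal.toReal_mul]
  · exact fun a _ => ENNReal.mul_ne_top (p.apply_ne_top a) ((g a).apply_ne_top b)

theorem prob_true_add_prob_false (p : PMF Bool) : prob p {true} + prob p {false} = 1 := by
  classical
  have h := sum_toReal_eq_one p
  rw [prob_eq_sum, prob_eq_sum]
  simpa using h

/-! ### Independent samples -/

theorem sum_fin_succ {A : Type} [Fintype A] {n : ℕ} (F : (Fin (n + 1) → A) → ℝ) :
    ∑ v, F v = ∑ a, ∑ v : Fin n → A, F (Fin.cons a v) := by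
  rw [← (Fin.consEquiv fun _ : Fin (n + 1) => A).sum_comp, Fintype.sum_prod_type]
  rfl

/-- Averages over `n` i.i.d. samples are sums against the product weights. -/
theorem prob_iidSample_bind {A B : Type} [Fintype A] (p : PMF A) (n : ℕ)
    (g : (Fin n → A) → PMF B) (S : Set B) :
    prob ((iidSample p n).bind g) S = ∑ v : Fin n → A, (∏ i, (p (v i)).toReal) * prob (g v) S := by
  induction n with
  | zero =>
    simp only [iidSample, PMF.pure_bind, Finset.univ_eq_empty, Finset.prod_empty, one_mul]
    rw [Fintype.sum_unique]
    congr 2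
  | succ n ih =>
    simp only [iidSample, PMF.bind_bind, PMF.bind_map]
    rw [prob_bind, sum_fin_succ]
    refine Finset.sum_congr rfl fun a _ => ?_
    rw [ih, Finset.mul_sum]
    refine Finset.sum_congr rfl fun v _ => ?_
    simp [Fin.prod_univ_succ, mul_assoc]

/-- When every user sends one message, the concatenated messages are independent. -/
theorem prob_concatMessages_bind {X Y B : Type} [Fintype Y] (M : X → PMF Y) (n : ℕ)
    (x : Fin n → X) (g : List Y → PMF B) (S : Set B) :
    prob ((concatMessages (fun x => (M x).map fun y => [y]) n x).bind g) S =
      ∑ v : Fin n → Y, (∏ i, (M (x i) (v i)).toReal) * prob (g (List.ofFn v)) S := by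
  induction n generalizing g with
  | zero =>
    simp [concatMessages, PMF.pure_bind]
  | succ n ih =>
    simp only [concatMessages, PMF.bind_bind, PMF.bind_map, Function.comp_def]
    rw [prob_bind, sum_fin_succ]
    refine Finset.sum_congr rfl fun a _ => ?_
    rw [ih, Finset.mul_sum]
    refine Finset.sum_congr rfl fun v _ => ?_
    simp [Fin.prod_univ_succ, mul_assoc, List.ofFn_succ, Fin.tail]

/-! ### Shuffling -/

/-- The index type of the permutation in `shuffle` depends on the list through its length; here the
length is replaced by a number `n` equal to it. -/
theorem shuffle_eq {Y : Type} (l : List Y) {n : ℕ} (h : l.length = n) :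
    shuffle l = (PMF.uniformOfFintype (Equiv.Perm (Fin n))).map
      fun σ => List.ofFn fun i => l.get ((σ i).cast h.symm) := by
  subst h; rfl

theorem shuffle_ofFn {Y : Type} {n : ℕ} (v : Fin n → Y) :
    shuffle (List.ofFn v) =
      (PMF.uniformOfFintype (Equiv.Perm (Fin n))).map
        fun σ : Equiv.Perm (Fin n) => List.ofFn (v ∘ σ) := by
  rw [shuffle_eq (List.ofFn v) (List.length_ofFn (f := v))]
  congr 1
  funext σ
  simp [Function.comp_def]

theorem uniformOfFintype_map_equiv {A : Type} [Fintype A] [Nonempty A] (e : A ≃ A) :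
    (PMF.uniformOfFintype A).map e = PMF.uniformOfFintype A := by
  classical
  ext a
  rw [PMF.map_apply, tsum_eq_single (e.symm a)]
  · simp
  · intro b hb
    rw [if_neg]
    rintro rfl
    simp at hb

theorem shuffle_ofFn_comp {Y : Type} {n : ℕ} (v : Fin n → Y) (σ : Equiv.Perm (Fin n)) :
    shuffle (List.ofFn (v ∘ σ)) = shuffle (List.ofFn v) := by
  rw [shuffle_ofFn, shuffle_ofFn]
  conv_rhs => rw [← uniformOfFintype_map_equiv (Equiv.mulLeft σ), PMF.map_comp]
  rfl

/-- An analyser that ignores the order of the messages does not notice the shuffler. -/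
theorem shuffle_bind_of_perm {Y Z : Type} (g : List Y → PMF Z)
    (hg : ∀ l l' : List Y, l.Perm l' → g l = g l') (l : List Y) : (shuffle l).bind g = g l := by
  have h : ∀ σ : Equiv.Perm (Fin l.length), g (List.ofFn fun i => l.get (σ i)) = g l := by
    intro σ
    apply hg
    have := Equiv.Perm.ofFn_comp_perm σ l.get
    simpa [Function.comp_def] using this
  simp only [shuffle, PMF.bind_map, Function.comp_def, h, PMF.bind_const]

/-! ### Privacy amplification by shuffling -/

section Clones

variable {I Y : Type} [Fintype I] [DecidableEq I] [Fintype Y]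

/-- If each of the independent `y i` is drawn from a mixture, the mean of `f y` is the mean over the
hidden labels `z` of the conditional mean of `f y`. -/
theorem sum_prod_mixture {Z : Type} [Fintype Z] [DecidableEq Z] (v : I → Z → ℝ) (Q : Z → I → Y → ℝ)
    (f : (I → Y) → ℝ) :
    ∑ y, (∏ i, ∑ z, v i z * Q z i (y i)) * f y =
      ∑ z : I → Z, (∏ i, v i (z i)) * ∑ y, (∏ i, Q (z i) i (y i)) * f y := by
  have h : ∀ y : I → Y, ∏ i, ∑ z, v i z * Q z i (y i) =
      ∑ z : I → Z, (∏ i, v i (z i)) * ∏ i, Q (z i) i (y i) := by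
    intro y
    rw [Finset.prod_univ_sum, Fintype.piFinset_univ]
    simp only [Finset.prod_mul_distrib]
  simp only [h, Finset.sum_mul, Finset.mul_sum]
  rw [Finset.sum_comm]
  simp only [mul_assoc]

/-- Averaging over the clones. A label `some b` marks a user whose message is distributed as that of
one of the two candidate inputs, and `none` any other user. Since `G` does not change when `j0` is
swapped with another labelled user, `g (z j0)` may be replaced by the average of `g (z j)` over all
labelled users `j`. -/
theorem clone_average (j0 : I) (g : Option Bool → ℝ) (hg : g none = 0)
    (G : (I → Option Bool) → ℝ)
    (hG : ∀ z j, z j0 ≠ none → z j ≠ none → G (z ∘ Equiv.swap j0 j) = G z) :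
    ∑ z, g (z j0) * G z =
      ∑ z, (if z j0 = none then 0 else
        (∑ j, g (z j)) / ∑ j, if z j = none then (0 : ℝ) else 1) * G z := by
  set c : (I → Option Bool) → ℝ := fun z => ∑ j, if z j = none then (0 : ℝ) else 1 with hc
  have hcpos : ∀ z, z j0 ≠ none → 0 < c z := by
    intro z hz
    have : (if z j0 = none then (0 : ℝ) else 1) ≤ c z :=
      Finset.single_le_sum (f := fun j => if z j = none then (0 : ℝ) else 1)
        (fun j _ => by split_ifs <;> simp) (Finset.mem_univ j0)
    rw [if_neg hz] at this
    linarith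
  have hcσ : ∀ z j, c (z ∘ Equiv.swap j0 j) = c z := fun z j =>
    Equiv.sum_comp (Equiv.swap j0 j) fun j => if z j = none then (0 : ℝ) else 1
  have hR : ∀ z, (if z j0 = none then 0 else (∑ j, g (z j)) / c z) * G z =
      ∑ j, if z j0 = none ∨ z j = none then 0 else g (z j) / c z * G z := by
    intro z
    by_cases hz : z j0 = none
    · simp [hz]
    · rw [if_neg hz, Finset.sum_div, Finset.sum_mul]
      simp only [hz, false_or]
      refine Finset.sum_congr rfl fun j _ => ?_
      split_ifs with h
      · simp [h, hg]
      · rfl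
  have hL : ∀ z, g (z j0) * G z =
      ∑ j, if z j0 = none ∨ z j = none then 0 else g (z j0) / c z * G z := by
    intro z
    by_cases hz : z j0 = none
    · simp [hz, hg]
    · have h1 : ∀ j, (if z j0 = none ∨ z j = none then 0 else g (z j0) / c z * G z) =
          (if z j = none then (0 : ℝ) else 1) * (g (z j0) / c z * G z) := by
        intro j
        by_cases h : z j = none <;> simp [h, hz]
      rw [Finset.sum_congr rfl fun j _ => h1 j, ← Finset.sum_mul]
      change _ = c z * _
      have := (hcpos z hz).ne'
      field_simp
  rw [Finset.sum_congr rfl fun z _ => hL z, Finset.sum_congr rfl fun z _ => hR z,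
    Finset.sum_comm]
  conv_rhs => rw [Finset.sum_comm]
  refine Finset.sum_congr rfl fun j _ => ?_
  rw [← ((Equiv.swap j0 j).arrowCongr (Equiv.refl (Option Bool))).sum_comp]
  refine Finset.sum_congr rfl fun z _ => ?_
  have he : ((Equiv.swap j0 j).arrowCongr (Equiv.refl (Option Bool))) z = z ∘ Equiv.swap j0 j := by
    ext i; simp [Equiv.arrowCongr]
  rw [he, hcσ]
  simp only [Function.comp_apply, Equiv.swap_apply_left, Equiv.swap_apply_right]
  by_cases h : z j0 = none ∨ z j = none
  · rw [if_pos h, if_pos h.symm]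
  · rw [if_neg h, if_neg (fun h' => h h'.symm)]
    rw [not_or] at h
    rw [hG z j h.1 h.2]

/-- The hockey-stick difference at level `E` is bounded by an exponential moment: after averaging
over the clones, only those `z` contribute for which the average of `w - E * w'` is positive, and on
them `exp (∑ j, h (z j)) ≥ 1`. -/
theorem clone_hockeyStick (j0 : I) (E : ℝ) (hE : 0 ≤ E) (w w' h : Option Bool → ℝ)
    (hw0 : w none = 0) (hw0' : w' none = 0) (hw : ∀ z, 0 ≤ w z) (hw' : ∀ z, 0 ≤ w' z)
    (G : (I → Option Bool) → ℝ) (hG0 : ∀ z, 0 ≤ G z)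
    (hG : ∀ z j, z j0 ≠ none → z j ≠ none → G (z ∘ Equiv.swap j0 j) = G z)
    (hbad : ∀ z : I → Option Bool, 0 < ∑ j, (w (z j) - E * w' (z j)) → 0 ≤ ∑ j, h (z j)) :
    ∑ z, (w (z j0) - E * w' (z j0)) * G z ≤
      ∑ z, w (z j0) * (Real.exp (∑ j, h (z j)) * G z) := by
  -- `clone_average` is used twice, the second time to return from the average to `w (z j0)`
  rw [clone_average j0 (fun z => w z - E * w' z) (by simp [hw0, hw0']) G hG,
    clone_average j0 w hw0 (fun z => Real.exp (∑ j, h (z j)) * G z)]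
  · refine Finset.sum_le_sum fun z _ => ?_
    rw [← mul_assoc]
    refine mul_le_mul_of_nonneg_right ?_ (hG0 z)
    split_ifs with hz
    · simp
    have hc : 0 ≤ ∑ j, if z j = none then (0 : ℝ) else 1 :=
      Finset.sum_nonneg fun j _ => by split_ifs <;> simp
    have hwn : 0 ≤ ∑ j, w (z j) := Finset.sum_nonneg fun j _ => hw _
    have hwn' : 0 ≤ ∑ j, w' (z j) := Finset.sum_nonneg fun j _ => hw' _
    rcases le_or_gt (∑ j, (w (z j) - E * w' (z j))) 0 with hle | hgt
    · exact (div_nonpos_of_nonpos_of_nonneg hle hc).trans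
        (mul_nonneg (div_nonneg hwn hc) (Real.exp_pos _).le)
    · calc (∑ j, (w (z j) - E * w' (z j))) / (∑ j, if z j = none then (0 : ℝ) else 1)
          ≤ (∑ j, w (z j)) / (∑ j, if z j = none then (0 : ℝ) else 1) := by
            refine div_le_div_of_nonneg_right ?_ hc
            rw [Finset.sum_sub_distrib, ← Finset.mul_sum]
            nlinarith [mul_nonneg hE hwn']
        _ ≤ _ := le_mul_of_one_le_right (div_nonneg hwn hc) (Real.one_le_exp (hbad z hgt))
  · intro z j hz hj
    rw [hG z j hz hj]
    congr 2
    exact Equiv.sum_comp (Equiv.swap j0 j) fun j => h (z j)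

/-- User `j0` draws a message from the `w`-mixture or from the `w'`-mixture of the `Q z j0`, and
every other user `i` from the `v`-mixture of the `Q z i`. If the components `Q (some b)` are common to
all users, the two laws of the unordered messages are close up to the exponential moment of
`∑ j, h (z j)`. -/
theorem mixture_hockeyStick (j0 : I) (E : ℝ) (hE : 0 ≤ E) (v w w' h : Option Bool → ℝ)
    (hw0 : w none = 0) (hw0' : w' none = 0) (hw : ∀ z, 0 ≤ w z) (hw' : ∀ z, 0 ≤ w' z)
    (hv : ∀ z, 0 ≤ v z) {c : ℝ} (hc : 0 < c) (hvc : ∀ b : Bool, v (some b) = c)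
    (Q : Option Bool → I → Y → ℝ) (hQ0 : ∀ z i y, 0 ≤ Q z i y) (hQ1 : ∀ z i, ∑ y, Q z i y = 1)
    (hQ : ∀ (b : Bool) i j, Q (some b) i = Q (some b) j)
    (f : (I → Y) → ℝ) (hf0 : ∀ y, 0 ≤ f y) (hf1 : ∀ y, f y ≤ 1)
    (hf : ∀ y (σ : Equiv.Perm I), f (y ∘ σ) = f y)
    (hbad : ∀ z : I → Option Bool, 0 < ∑ j, (w (z j) - E * w' (z j)) → 0 ≤ ∑ j, h (z j)) :
    ∑ y, (∏ i, ∑ z, (if i = j0 then w z else v z) * Q z i (y i)) * f y ≤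
      E * ∑ y, (∏ i, ∑ z, (if i = j0 then w' z else v z) * Q z i (y i)) * f y +
      (∑ z, w z * Real.exp (h z)) * (∑ z, v z * Real.exp (h z)) ^ (Fintype.card I - 1) := by
  classical
  set F : (I → Option Bool) → ℝ := fun z => ∑ y, (∏ i, Q (z i) i (y i)) * f y with hF
  have hF0 : ∀ z, 0 ≤ F z := fun z => Finset.sum_nonneg fun y _ =>
    mul_nonneg (Finset.prod_nonneg fun i _ => hQ0 _ _ _) (hf0 y)
  have hF1 : ∀ z, F z ≤ 1 := by
    intro z
    calc F z ≤ ∑ y : I → Y, ∏ i, Q (z i) i (y i) := Finset.sum_le_sum fun y _ =>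
          mul_le_of_le_one_right (Finset.prod_nonneg fun i _ => hQ0 _ _ _) (hf1 y)
      _ = ∏ i, ∑ y, Q (z i) i y := by
          rw [Finset.prod_univ_sum, Fintype.piFinset_univ]
      _ = 1 := by simp [hQ1]
  have hFswap : ∀ z j, z j0 ≠ none → z j ≠ none → F (z ∘ Equiv.swap j0 j) = F z := by
    intro z j hz hj
    simp only [hF]
    rw [← ((Equiv.swap j0 j).arrowCongr (Equiv.refl Y)).sum_comp]
    refine Finset.sum_congr rfl fun y _ => ?_
    have he : ((Equiv.swap j0 j).arrowCongr (Equiv.refl Y)) y = y ∘ Equiv.swap j0 j := by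
      ext i; simp [Equiv.arrowCongr]
    rw [he, hf]
    congr 1
    rw [← Equiv.prod_comp (Equiv.swap j0 j)]
    refine Finset.prod_congr rfl fun i _ => ?_
    simp only [Function.comp_apply, Equiv.swap_apply_self]
    obtain ⟨b0, hb0⟩ := Option.ne_none_iff_exists'.mp hz
    obtain ⟨b, hb⟩ := Option.ne_none_iff_exists'.mp hj
    by_cases h0 : i = j0
    · subst h0; rw [hb0, hQ b0 _ i]
    · by_cases h1 : i = j
      · subst h1; rw [hb, hQ b _ i]
      · rw [Equiv.swap_apply_of_ne_of_ne h0 h1]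
  set G : (I → Option Bool) → ℝ := fun z => (∏ i, v (z i)) * F z with hGdef
  have hG0 : ∀ z, 0 ≤ G z := fun z => mul_nonneg (Finset.prod_nonneg fun i _ => hv _) (hF0 z)
  have hG : ∀ z j, z j0 ≠ none → z j ≠ none → G (z ∘ Equiv.swap j0 j) = G z := by
    intro z j hz hj
    simp only [hGdef, hFswap z j hz hj]
    congr 1
    exact Equiv.prod_comp (Equiv.swap j0 j) fun i => v (z i)
  have key := clone_hockeyStick j0 E hE w w' h hw0 hw0' hw hw' G hG0 hG hbad
  -- replacing the weight of the clone at `j0` by `v` costs the constant factor `c`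
  have hprod : ∀ (a : Option Bool → ℝ), a none = 0 → ∀ e : Option Bool → ℝ, ∀ z : I → Option Bool,
      a (z j0) * ∏ i, (v (z i) * e (z i)) =
        c * ∏ i, ((if i = j0 then a (z i) else v (z i)) * e (z i)) := by
    intro a ha e z
    rw [Fintype.prod_eq_mul_prod_compl j0, Fintype.prod_eq_mul_prod_compl j0, if_pos rfl]
    have h2 : ∏ i ∈ {j0}ᶜ, ((if i = j0 then a (z i) else v (z i)) * e (z i)) =
        ∏ i ∈ {j0}ᶜ, (v (z i) * e (z i)) :=
      Finset.prod_congr rfl fun i hi => by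
        rw [if_neg]; simpa using hi
    rw [h2]
    rcases hz : z j0 with _ | b
    · simp [ha]
    · rw [hvc]; ring
  have hexpand : ∀ a : Option Bool → ℝ, a none = 0 →
      c * ∑ y, (∏ i, ∑ z, (if i = j0 then a z else v z) * Q z i (y i)) * f y =
        ∑ z, a (z j0) * G z := by
    intro a ha
    rw [sum_prod_mixture (fun i z => if i = j0 then a z else v z), Finset.mul_sum]
    refine Finset.sum_congr rfl fun z _ => ?_
    have := hprod a ha (fun _ => 1) z
    simp only [mul_one] at this
    simp only [hGdef]
    rw [← mul_assoc, ← mul_assoc, this]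
  have hlast : ∑ z, w (z j0) * (Real.exp (∑ j, h (z j)) * G z) ≤
      c * ((∑ z, w z * Real.exp (h z)) *
        (∑ z, v z * Real.exp (h z)) ^ (Fintype.card I - 1)) := by
    calc ∑ z, w (z j0) * (Real.exp (∑ j, h (z j)) * G z)
        ≤ ∑ z : I → Option Bool, w (z j0) * ∏ i, (v (z i) * Real.exp (h (z i))) := by
          refine Finset.sum_le_sum fun z _ => mul_le_mul_of_nonneg_left ?_ (hw _)
          rw [Finset.prod_mul_distrib, Real.exp_sum]
          have h1 : 0 ≤ ∏ i, Real.exp (h (z i)) := Finset.prod_nonneg fun i _ => (Real.exp_pos _).le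
          have h2 : 0 ≤ ∏ i, v (z i) := Finset.prod_nonneg fun i _ => hv _
          simp only [hGdef]
          nlinarith [hF1 z, mul_nonneg h1 h2]
      _ = c * ∑ z : I → Option Bool,
            ∏ i, ((if i = j0 then w (z i) else v (z i)) * Real.exp (h (z i))) := by
          rw [Finset.mul_sum]
          exact Finset.sum_congr rfl fun z _ => hprod w hw0 (fun x => Real.exp (h x)) z
      _ = c * ∏ i, ∑ z, (if i = j0 then w z else v z) * Real.exp (h z) := by
          rw [Finset.prod_univ_sum, Fintype.piFinset_univ]
      _ = _ := by
          rw [Fintype.prod_eq_mul_prod_compl j0]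
          simp only [if_true]
          congr 2
          rw [Finset.prod_congr rfl (g := fun _ => ∑ z, v z * Real.exp (h z))]
          · rw [Finset.prod_const, Finset.card_compl, Finset.card_singleton]
          · intro i hi
            have : i ≠ j0 := by simpa using hi
            simp [this]
  have e1 := hexpand w hw0
  have e2 := hexpand w' hw0'
  simp only [sub_mul, Finset.sum_sub_distrib, mul_assoc, ← Finset.mul_sum] at key
  rw [← e1, ← e2] at key
  refine le_of_mul_le_mul_left ?_ hc
  linarith

end Clones

theorem exp_neg_le_one_sub_half {t : ℝ} (h0 : 0 ≤ t) (h1 : t ≤ 1) : Real.exp (-t) ≤ 1 - t / 2 := by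
  rw [Real.exp_neg]
  refine inv_le_of_inv_le₀ (by linarith) ?_
  refine le_trans ?_ (Real.add_one_le_exp t)
  rw [inv_le_iff_one_le_mul₀ (by linarith)]
  nlinarith

/-- The exponential moment of one user in the Chernoff bound: a user is a clone with probability
`1 / u`, and with `η = 2 √(u L)` and `λ = 4 η` the two kinds of clones contribute `λ (1/2 - η)` and
`λ (-1/2 - η)` to the exponent. -/
theorem clone_chernoff {u L : ℝ} (hu : 1 < u) (hx : u * L ≤ 1 / 16) (hL : 0 < L) :
    (1 - 1 / u) + 1 / (2 * u) * Real.exp (8 * √(u * L) * (1 / 2 - 2 * √(u * L))) +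
      1 / (2 * u) * Real.exp (8 * √(u * L) * (-(1 / 2) - 2 * √(u * L))) ≤ Real.exp (-(4 * L)) := by
  have hu0 : 0 < u := by linarith
  have hx0 : 0 ≤ u * L := by positivity
  set s := √(u * L) with hs
  have hss : s * s = u * L := Real.mul_self_sqrt hx0
  have h1 : Real.exp (8 * s * (1 / 2 - 2 * s)) + Real.exp (8 * s * (-(1 / 2) - 2 * s)) =
      2 * (Real.exp (-(16 * (u * L))) * Real.cosh (4 * s)) := by
    rw [Real.cosh_eq, ← hss]
    have e1 : 8 * s * (1 / 2 - 2 * s) = -(16 * (s * s)) + 4 * s := by ring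
    have e2 : 8 * s * (-(1 / 2) - 2 * s) = -(16 * (s * s)) + -(4 * s) := by ring
    rw [e1, e2, Real.exp_add, Real.exp_add]
    ring
  have h2 : Real.exp (-(16 * (u * L))) * Real.cosh (4 * s) ≤ Real.exp (-(8 * (u * L))) := by
    calc _ ≤ Real.exp (-(16 * (u * L))) * Real.exp ((4 * s) ^ 2 / 2) :=
          mul_le_mul_of_nonneg_left (Real.cosh_le_exp_half_sq _) (Real.exp_pos _).le
      _ = _ := by
          rw [← Real.exp_add]
          congr 1
          nlinarith
  have h3 : Real.exp (-(8 * (u * L))) ≤ 1 - 8 * (u * L) / 2 :=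
    exp_neg_le_one_sub_half (by linarith) (by linarith)
  calc _ = (1 - 1 / u) + 1 / (2 * u) * (Real.exp (8 * s * (1 / 2 - 2 * s)) +
        Real.exp (8 * s * (-(1 / 2) - 2 * s))) := by ring
    _ ≤ (1 - 1 / u) + 1 / (2 * u) * (2 * (1 - 8 * (u * L) / 2)) := by
        rw [h1]
        gcongr
        exact h2.trans h3
    _ = 1 - 4 * L := by field_simp; ring
    _ ≤ _ := by linarith [Real.add_one_le_exp (-(4 * L))]

/-- Hiding among the clones. With `p = u / (u + 1)`, the candidate laws of the message of `j0` are
`p Q₀ + (1 - p) Q₁` and `(1 - p) Q₀ + p Q₁` for two laws `Q₀`, `Q₁`, and every other user draws from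
`Q₀` and from `Q₁` with probability `1 / (2 u)` each. -/
theorem clones_hockeyStick {I Y : Type} [Fintype I] [DecidableEq I] [Fintype Y] (j0 : I)
    (r : I → Y → ℝ) (r' : Y → ℝ) (hr1 : ∀ i, ∑ y, r i y = 1) (hr1' : ∑ y, r' y = 1)
    {u E L : ℝ} (hu : 1 < u) (hL : 0 < L) (hx : u * L ≤ 1 / 16) (hE1 : 1 ≤ E) (hE3 : E ≤ 3)
    (hE : E - 1 = 16 * ((u - 1) / (u + 1)) * √(u * L))
    (h1 : ∀ y, r j0 y ≤ u * r' y) (h2 : ∀ y, r' y ≤ u * r j0 y)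
    (h3 : ∀ i y, r j0 y ≤ u * r i y) (h4 : ∀ i y, r' y ≤ u * r i y)
    (f : (I → Y) → ℝ) (hf0 : ∀ y, 0 ≤ f y) (hf1 : ∀ y, f y ≤ 1)
    (hf : ∀ y (σ : Equiv.Perm I), f (y ∘ σ) = f y) :
    ∑ y, (∏ i, r i (y i)) * f y ≤
      E * ∑ y, (∏ i, if i = j0 then r' (y i) else r i (y i)) * f y +
      Real.exp (1 - 4 * L * (Fintype.card I - 1 : ℕ)) := by
  have hu0 : 0 < u := by linarith
  have hu1 : 0 < u - 1 := by linarith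
  have hu2 : 0 < u + 1 := by linarith
  set s := √(u * L) with hs
  have hs0 : 0 ≤ s := Real.sqrt_nonneg _
  have hs1 : s ≤ 1 / 4 := by
    rw [hs, show (1 / 4 : ℝ) = √(1 / 16) by
      rw [show (1 / 16 : ℝ) = (1 / 4) ^ 2 by norm_num]; rw [Real.sqrt_sq (by norm_num)]]
    exact Real.sqrt_le_sqrt hx
  -- `some false` stands for `Q₀`, `some true` for `Q₁`, and `none` for the rest of the user's law
  let w : Option Bool → ℝ := fun z => z.elim 0 fun b => bif b then 1 / (u + 1) else u / (u + 1)
  let w' : Option Bool → ℝ := fun z => z.elim 0 fun b => bif b then u / (u + 1) else 1 / (u + 1)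
  let v : Option Bool → ℝ := fun z => z.elim (1 - 1 / u) fun _ => 1 / (2 * u)
  let h : Option Bool → ℝ := fun z => z.elim 0 fun b =>
    bif b then 8 * s * (-(1 / 2) - 2 * s) else 8 * s * (1 / 2 - 2 * s)
  let Q : Option Bool → I → Y → ℝ := fun z i y => z.elim
    ((r i y - 1 / (2 * u) * (r j0 y + r' y)) / (1 - 1 / u)) fun b =>
    bif b then (u * r' y - r j0 y) / (u - 1) else (u * r j0 y - r' y) / (u - 1)
  have hv0 : 0 < 1 - 1 / u := by
    rw [sub_pos, div_lt_one hu0]; exact hu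
  have hv0' : u - 1 ≠ 0 := hu1.ne'
  have key := mixture_hockeyStick j0 E (by linarith) v w w' h rfl rfl
    (by rintro (_ | _ | _) <;> simp [w] <;> positivity)
    (by rintro (_ | _ | _) <;> simp [w'] <;> positivity)
    (by rintro (_ | _) <;> simp only [v, Option.elim] <;> positivity)
    (c := 1 / (2 * u)) (by positivity) (fun b => rfl) Q
    (by
      rintro (_ | _ | _) i y
      · refine div_nonneg ?_ hv0.le
        have e : 1 / (2 * u) * (r j0 y + r' y) ≤ 1 / (2 * u) * (2 * u * r i y) := by
          gcongr
          linarith [h3 i y, h4 i y]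
        have e' : 1 / (2 * u) * (2 * u * r i y) = r i y := by field_simp
        linarith
      · exact div_nonneg (by linarith [h2 y]) hu1.le
      · exact div_nonneg (by linarith [h1 y]) hu1.le)
    (by
      rintro (_ | _ | _) i
      · simp only [Q, Option.elim, ← Finset.sum_div, Finset.sum_sub_distrib, ← Finset.mul_sum,
          Finset.sum_add_distrib, hr1, hr1']
        field_simp
        ring
      · simp only [Q, Option.elim, cond_false, ← Finset.sum_div, Finset.sum_sub_distrib,
          ← Finset.mul_sum, hr1, hr1']
        field_simp
      · simp only [Q, Option.elim, cond_true, ← Finset.sum_div, Finset.sum_sub_distrib,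
          ← Finset.mul_sum, hr1, hr1']
        field_simp)
    (fun b i j => rfl) f hf0 hf1 hf
    (by
      intro z hz
      -- the exponent dominates a positive multiple of the hockey-stick integrand, pointwise
      have hκ : 0 ≤ (u + 1) * (8 * s) / ((u - 1) * (1 + E)) := by positivity
      have hη : 2 * s ≤ 8 * s / (1 + E) := by
        rw [le_div_iff₀ (by linarith)]
        nlinarith
      have hEu : (u + 1) * (E - 1) = (u - 1) * (16 * s) := by
        rw [hE]; field_simp
      have hpt : ∀ o, (u + 1) * (8 * s) / ((u - 1) * (1 + E)) * (w o - E * w' o) ≤ h o := by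
        have hE0 : (1 + E) ≠ 0 := by linarith
        rintro (_ | _ | _)
        · simp [w, w', h]
        · have e : (u + 1) * (8 * s) / ((u - 1) * (1 + E)) * (u / (u + 1) - E * (1 / (u + 1))) =
              8 * s * (1 / 2 - 8 * s / (1 + E)) := by
            field_simp
            linear_combination (-s) * hEu
          simp only [w, w', h, Option.elim, cond_false]
          rw [e]
          gcongr
        · have e : (u + 1) * (8 * s) / ((u - 1) * (1 + E)) * (1 / (u + 1) - E * (u / (u + 1))) =
              8 * s * (-(1 / 2) - 8 * s / (1 + E)) := by
            field_simp
            linear_combination (-s) * hEu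
          simp only [w, w', h, Option.elim, cond_true]
          rw [e]
          gcongr
      calc (0 : ℝ) ≤ (u + 1) * (8 * s) / ((u - 1) * (1 + E)) * ∑ j, (w (z j) - E * w' (z j)) :=
            mul_nonneg hκ hz.le
        _ ≤ _ := by
            rw [Finset.mul_sum]
            exact Finset.sum_le_sum fun j _ => hpt (z j))
  have hmix : ∀ i y, ∑ z, (if i = j0 then w z else v z) * Q z i y = r i y := by
    intro i y
    have hv1 : 1 - 1 / u ≠ 0 := hv0.ne'
    by_cases hi : i = j0
    · subst hi
      simp [Fintype.sum_option, w, Q]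
      field_simp
      ring
    · simp only [if_neg hi, Fintype.sum_option, Fintype.sum_bool, v, Q, Option.elim, cond_true,
        cond_false]
      rw [mul_div_cancel₀ _ hv1]
      field_simp
      ring
  have hmix' : ∀ i y, ∑ z, (if i = j0 then w' z else v z) * Q z i y =
      if i = j0 then r' y else r i y := by
    intro i y
    by_cases hi : i = j0
    · subst hi
      simp [Fintype.sum_option, w', Q]
      field_simp
      ring
    · rw [← hmix i y]
      simp [hi]
  simp only [hmix, hmix'] at key
  refine key.trans (add_le_add_right ?_ _)
  have hA : ∑ z, w z * Real.exp (h z) ≤ Real.exp 1 := by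
    have hw : ∑ z, w z = 1 := by
      simp [Fintype.sum_option, w]
      field_simp
      ring
    rw [← one_mul (Real.exp 1), ← hw, Finset.sum_mul]
    refine Finset.sum_le_sum fun z _ => mul_le_mul_of_nonneg_left ?_ ?_
    · rw [Real.exp_le_exp]
      rcases z with (_ | _ | _) <;> simp only [h, Option.elim, cond_true, cond_false] <;> nlinarith
    · rcases z with (_ | _ | _) <;> simp [w] <;> positivity
  have hB : ∑ z, v z * Real.exp (h z) ≤ Real.exp (-(4 * L)) := by
    refine le_of_eq_of_le ?_ (clone_chernoff hu hx hL)
    simp [Fintype.sum_option, v, h, ← hs]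
    ring
  have hB0 : 0 ≤ ∑ z, v z * Real.exp (h z) := Finset.sum_nonneg fun z _ =>
    mul_nonneg (by rcases z with (_ | _) <;> simp only [v, Option.elim] <;> positivity)
      (Real.exp_pos _).le
  calc _ ≤ Real.exp 1 * Real.exp (-(4 * L)) ^ (Fintype.card I - 1) := by
        gcongr
    _ = _ := by
        rw [← Real.exp_nat_mul, ← Real.exp_add]
        congr 1
        ring

/-- Privacy amplification by shuffling: `m` users with a `log u`-locally private randomiser are
`(log E, 4 e^(-m L))`-differentially private, where `E = 1 + 16 (u - 1) / (u + 1) √(u L)`. -/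
theorem shuffle_amplification {X Y : Type} [DecidableEq X] [Fintype Y] (M : X → PMF Y)
    {u E L : ℝ} (hu : 1 < u) (hM : ∀ x x' y, (M x y).toReal ≤ u * (M x' y).toReal) (hL : 0 < L)
    (hE1 : 1 ≤ E) (hE3 : E ≤ 3) (hE : E - 1 = 16 * ((u - 1) / (u + 1)) * √(u * L)) (m : ℕ)
    (x x' : Fin m → X) (hxx : hammingDist x x' ≤ 1) (S : Set (List Y)) :
    prob ((concatMessages (fun x => (M x).map fun y => [y]) m x).bind shuffle) S ≤
      E * prob ((concatMessages (fun x => (M x).map fun y => [y]) m x').bind shuffle) S +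
        4 * Real.exp (-(m * L)) := by
  have hδ := Real.exp_pos (-(m * L))
  rcases le_or_gt 1 (4 * Real.exp (-(m * L))) with htriv | hδ1
  · have := mul_nonneg (by linarith : (0 : ℝ) ≤ E) (prob_nonneg
      ((concatMessages (fun x => (M x).map fun y => [y]) m x').bind shuffle) S)
    linarith [prob_le_one ((concatMessages (fun x => (M x).map fun y => [y]) m x).bind shuffle) S]
  by_cases hne : x = x'
  · subst hne
    nlinarith [prob_nonneg ((concatMessages (fun x => (M x).map fun y => [y]) m x).bind shuffle) S]
  obtain ⟨j0, hj0⟩ := Function.ne_iff.mp hne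
  have hrest : ∀ i, i ≠ j0 → x i = x' i := by
    intro i hi
    by_contra hxi
    exact hi (Finset.card_le_one.mp hxx i (by simpa using hxi) j0 (by simpa using hj0))
  rw [prob_concatMessages_bind, prob_concatMessages_bind]
  set f : (Fin m → Y) → ℝ := fun y => prob (shuffle (List.ofFn y)) S with hf
  have hf0 : ∀ y, 0 ≤ f y := fun y => prob_nonneg _ _
  set r : Fin m → Y → ℝ := fun i y => (M (x i) y).toReal with hr
  have hr0 : ∀ i y, 0 ≤ r i y := fun i y => ENNReal.toReal_nonneg
  have hprod : ∀ y : Fin m → Y, ∏ i, (M (x' i) (y i)).toReal =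
      ∏ i, if i = j0 then (M (x' j0) (y i)).toReal else r i (y i) := by
    intro y
    refine Finset.prod_congr rfl fun i _ => ?_
    split_ifs with hi
    · rw [hi]
    · rw [← hrest i hi]
  simp only [hprod]
  rcases le_or_gt (u * L) (1 / 16) with hx | hx
  · have h := clones_hockeyStick j0 r (fun y => (M (x' j0) y).toReal)
      (fun i => sum_toReal_eq_one _) (sum_toReal_eq_one _) hu hL hx hE1 hE3 hE
      (fun y => hM _ _ y) (fun y => hM _ _ y) (fun i y => hM _ _ y) (fun i y => hM _ _ y)
      f hf0 (fun y => prob_le_one _ _) (fun y σ => by simp only [hf, shuffle_ofFn_comp])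
    refine h.trans (add_le_add_right ?_ _)
    have hL16 : L ≤ 1 / 16 := by nlinarith
    -- a single user would make `4 e^(-m L)` exceed `1`
    have hm : 2 ≤ m := by
      by_contra hm
      have hm1 : (m : ℝ) ≤ 1 := by
        have : m ≤ 1 := by omega
        exact_mod_cast this
      nlinarith [Real.add_one_le_exp (-(m * L))]
    have hmR : (2 : ℝ) ≤ m := by exact_mod_cast hm
    rw [Fintype.card_fin, Nat.cast_sub (by omega), Nat.cast_one]
    calc Real.exp (1 - 4 * L * (m - 1)) ≤ Real.exp (1 + -(m * L)) := by
          rw [Real.exp_le_exp]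
          nlinarith
      _ = Real.exp 1 * Real.exp (-(m * L)) := Real.exp_add _ _
      _ ≤ 4 * Real.exp (-(m * L)) := by
          gcongr
          linarith [Real.exp_one_lt_d9]
  · -- here the local privacy of the randomiser suffices
    have hs : 1 / 4 < √(u * L) := by
      rw [Real.lt_sqrt (by norm_num)]
      norm_num at hx ⊢
      exact hx
    have hu2 : 0 < u + 1 := by linarith
    have hu3 : u < 3 := by
      by_contra hu3
      have : 1 / 2 ≤ (u - 1) / (u + 1) := by
        rw [le_div_iff₀ hu2]
        linarith
      nlinarith
    have huE : u ≤ E := by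
      have : (u - 1) / 4 ≤ (u - 1) / (u + 1) := by
        (gcongr; linarith)
      nlinarith
    refine le_add_of_le_of_nonneg ?_ (by positivity)
    rw [Finset.mul_sum]
    refine Finset.sum_le_sum fun y _ => ?_
    rw [← mul_assoc]
    refine mul_le_mul_of_nonneg_right ?_ (hf0 y)
    rw [Fintype.prod_eq_mul_prod_compl j0, Fintype.prod_eq_mul_prod_compl j0, if_pos rfl,
      ← mul_assoc]
    have e : ∏ i ∈ {j0}ᶜ, (if i = j0 then (M (x' j0) (y i)).toReal else r i (y i)) =
        ∏ i ∈ {j0}ᶜ, r i (y i) :=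
      Finset.prod_congr rfl fun i hi => by rw [if_neg]; simpa using hi
    rw [e]
    refine mul_le_mul_of_nonneg_right ?_ (Finset.prod_nonneg fun i _ => hr0 _ _)
    exact (hM _ _ _).trans (mul_le_mul_of_nonneg_right huE ENNReal.toReal_nonneg)

/-! ### Moments of sums of i.i.d. vectors -/

/-- The mean of `f` over `n` independent samples with weights `π` (which need not be normalised). -/
def iidMean {W : Type} [Fintype W] (π : W → ℝ) (n : ℕ) (f : (Fin n → W) → ℝ) : ℝ :=
  ∑ v, (∏ i, π (v i)) * f v

section OffDiag

variable {W H : Type} {n : ℕ} [NormedAddCommGroup H] [InnerProductSpace ℝ H]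

/-- The off-diagonal part `∑_{i ≠ j} ⟪D (v i), D (v j)⟫` of `‖∑ i, D (v i)‖²`. -/
def offDiagSum (D : W → H) (v : Fin n → W) : ℝ := ‖∑ i, D (v i)‖ ^ 2 - ∑ i, ‖D (v i)‖ ^ 2

theorem offDiagSum_cons (D : W → H) (a : W) (v : Fin n → W) :
    offDiagSum D (Fin.cons a v : Fin (n + 1) → W) =
      offDiagSum D v + 2 * inner ℝ (∑ i, D (v i)) (D a) := by
  unfold offDiagSum
  simp only [Fin.sum_univ_succ, Fin.cons_zero, Fin.cons_succ, norm_add_sq_real]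
  rw [real_inner_comm]
  ring

/-- The Hoeffding decomposition of the off-diagonal sum into a degenerate part, a linear part and a
constant; when `μ` is the mean of `D`, the constant is the mean. -/
theorem offDiagSum_eq_centered (D : W → H) (μ : H) (v : Fin n → W) :
    offDiagSum D v = offDiagSum (fun a => D a - μ) v +
      2 * (n - 1) * inner ℝ (∑ i, (D (v i) - μ)) μ + n * (n - 1) * ‖μ‖ ^ 2 := by
  unfold offDiagSum
  have h1 : ∑ i, D (v i) = ∑ i, (D (v i) - μ) + (n : ℝ) • μ := by
    simp [Finset.sum_sub_distrib, ← Nat.cast_smul_eq_nsmul ℝ]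
  have h2 : ∀ i, ‖D (v i)‖ ^ 2 = ‖D (v i) - μ‖ ^ 2 + 2 * inner ℝ (D (v i) - μ) μ + ‖μ‖ ^ 2 := by
    intro i
    conv_lhs => rw [show D (v i) = (D (v i) - μ) + μ by abel]
    rw [norm_add_sq_real]
  rw [h1, norm_add_sq_real, Finset.sum_congr rfl fun i _ => h2 i]
  simp only [Finset.sum_add_distrib, ← Finset.mul_sum, ← sum_inner]
  rw [real_inner_smul_right, norm_smul, mul_pow]
  simp
  ring

end OffDiag

section Moments

variable {W : Type} [Fintype W] {π : W → ℝ} {n : ℕ}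

theorem iidMean_succ (f : (Fin (n + 1) → W) → ℝ) :
    iidMean π (n + 1) f = ∑ a, π a * iidMean π n fun v => f (Fin.cons a v) := by
  unfold iidMean
  rw [sum_fin_succ]
  refine Finset.sum_congr rfl fun a _ => ?_
  rw [Finset.mul_sum]
  refine Finset.sum_congr rfl fun v _ => ?_
  simp [Fin.prod_univ_succ, mul_assoc]

theorem iidMean_add (f g : (Fin n → W) → ℝ) :
    iidMean π n (fun v => f v + g v) = iidMean π n f + iidMean π n g := by
  simp [iidMean, mul_add, Finset.sum_add_distrib]

theorem iidMean_const_mul (c : ℝ) (f : (Fin n → W) → ℝ) :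
    iidMean π n (fun v => c * f v) = c * iidMean π n f := by
  simp only [iidMean, Finset.mul_sum]
  exact Finset.sum_congr rfl fun v _ => by ring

theorem iidMean_mono (hπ : ∀ a, 0 ≤ π a) {f g : (Fin n → W) → ℝ} (h : ∀ v, f v ≤ g v) :
    iidMean π n f ≤ iidMean π n g :=
  Finset.sum_le_sum fun v _ =>
    mul_le_mul_of_nonneg_left (h v) (Finset.prod_nonneg fun _ _ => hπ _)

theorem iidMean_const (hπ1 : ∑ a, π a = 1) (c : ℝ) : iidMean π n (fun _ => c) = c := by
  unfold iidMean
  rw [← Finset.sum_mul]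
  have h := Finset.prod_univ_sum (fun _ : Fin n => (Finset.univ : Finset W)) (fun _ a => π a)
  rw [Fintype.piFinset_univ] at h
  rw [← h]
  simp [hπ1]

theorem iidMean_sum_apply (hπ1 : ∑ a, π a = 1) (b : W → ℝ) :
    iidMean π n (fun v => ∑ i, b (v i)) = n * ∑ a, π a * b a := by
  induction n with
  | zero => simp [iidMean]
  | succ n ih =>
    rw [iidMean_succ]
    simp only [Fin.sum_univ_succ, Fin.cons_zero, Fin.cons_succ, iidMean_add, ih,
      iidMean_const hπ1, mul_add, Finset.sum_add_distrib, ← Finset.sum_mul, hπ1]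
    push_cast
    ring

variable {H : Type} [NormedAddCommGroup H] [InnerProductSpace ℝ H]

theorem sum_mul_inner (π : W → ℝ) (Z : W → H) (x : H) :
    ∑ a, π a * inner ℝ (Z a) x = inner ℝ (∑ a, π a • Z a) x := by
  simp [sum_inner, real_inner_smul_left]

theorem iidMean_inner_sq (hπ1 : ∑ a, π a = 1) {Z : W → H} (hZ : ∑ a, π a • Z a = 0) (x : H) :
    iidMean π n (fun v => inner ℝ (∑ i, Z (v i)) x ^ 2) = n * ∑ a, π a * inner ℝ (Z a) x ^ 2 := by
  induction n with
  | zero => simp [iidMean]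
  | succ n ih =>
    have h0 : ∑ a, π a * inner ℝ (Z a) x = 0 := by rw [sum_mul_inner, hZ, inner_zero_left]
    rw [iidMean_succ]
    have h : ∀ a, iidMean π n (fun v =>
        inner ℝ (∑ i, Z ((Fin.cons a v : Fin (n + 1) → W) i)) x ^ 2) =
        inner ℝ (Z a) x ^ 2 + (2 * inner ℝ (Z a) x) *
          iidMean π n (fun v => inner ℝ (∑ i, Z (v i)) x) +
        n * ∑ a, π a * inner ℝ (Z a) x ^ 2 := by
      intro a
      rw [← ih, ← iidMean_const_mul, ← iidMean_const (n := n) hπ1 (inner ℝ (Z a) x ^ 2),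
        ← iidMean_add, ← iidMean_add]
      congr 1
      funext v
      rw [Fin.sum_univ_succ, inner_add_left]
      simp only [Fin.cons_zero, Fin.cons_succ]
      ring
    simp only [h, mul_add, Finset.sum_add_distrib, ← Finset.sum_mul, hπ1]
    have h2 : ∀ c : ℝ, ∑ a, π a * (2 * inner ℝ (Z a) x * c) = 0 := by
      intro c
      calc _ = (2 * c) * ∑ a, π a * inner ℝ (Z a) x := by
            rw [Finset.mul_sum]; exact Finset.sum_congr rfl fun a _ => by ring
        _ = 0 := by rw [h0, mul_zero]
    rw [h2]
    push_cast
    ring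

theorem iidMean_offDiagSum_sq (hπ1 : ∑ a, π a = 1) {Z : W → H} (hZ : ∑ a, π a • Z a = 0) :
    iidMean π n (fun v => offDiagSum Z v ^ 2) =
      2 * n * (n - 1) * ∑ a, π a * ∑ b, π b * inner ℝ (Z b) (Z a) ^ 2 := by
  induction n with
  | zero => simp [iidMean, offDiagSum]
  | succ n ih =>
    rw [iidMean_succ]
    have h : ∀ a, iidMean π n (fun v => offDiagSum Z (Fin.cons a v : Fin (n + 1) → W) ^ 2) =
        iidMean π n (fun v => offDiagSum Z v ^ 2) +
        4 * iidMean π n (fun v => offDiagSum Z v * inner ℝ (Z a) (∑ i, Z (v i))) +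
        4 * (n * ∑ b, π b * inner ℝ (Z b) (Z a) ^ 2) := by
      intro a
      rw [← iidMean_inner_sq hπ1 hZ (Z a), ← iidMean_const_mul, ← iidMean_const_mul,
        ← iidMean_add, ← iidMean_add]
      congr 1
      funext v
      rw [offDiagSum_cons, real_inner_comm (∑ i, Z (v i)) (Z a)]
      ring
    have hcross : ∑ a, π a * iidMean π n
        (fun v => offDiagSum Z v * inner ℝ (Z a) (∑ i, Z (v i))) = 0 := by
      simp only [iidMean, Finset.mul_sum]
      rw [Finset.sum_comm]
      refine Finset.sum_eq_zero fun v _ => ?_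
      calc _ = ((∏ i, π (v i)) * offDiagSum Z v) *
            ∑ a, π a * inner ℝ (Z a) (∑ i, Z (v i)) := by
            rw [Finset.mul_sum]; exact Finset.sum_congr rfl fun a _ => by ring
        _ = 0 := by rw [sum_mul_inner, hZ, inner_zero_left, mul_zero]
    simp only [h, mul_add, Finset.sum_add_distrib, ← Finset.sum_mul, hπ1]
    have h4 : ∑ a, π a * (4 * iidMean π n
        (fun v => offDiagSum Z v * inner ℝ (Z a) (∑ i, Z (v i)))) = 0 := by
      rw [← mul_zero 4, ← hcross, Finset.mul_sum]
      exact Finset.sum_congr rfl fun a _ => by ring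
    have h5 : ∑ a, π a * (4 * (n * ∑ b, π b * inner ℝ (Z b) (Z a) ^ 2)) =
        4 * n * ∑ a, π a * ∑ b, π b * inner ℝ (Z b) (Z a) ^ 2 := by
      rw [Finset.mul_sum]
      exact Finset.sum_congr rfl fun a _ => by ring
    rw [h4, h5, ih]
    push_cast
    ring

/-- Centring does not increase second moments. -/
theorem sum_inner_sub_sq_le (hπ1 : ∑ a, π a = 1) {D : W → H} {μ : H} (hμ : ∑ a, π a • D a = μ)
    (x : H) : ∑ a, π a * inner ℝ (D a - μ) x ^ 2 ≤ ∑ a, π a * inner ℝ (D a) x ^ 2 := by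
  have h : ∀ a, π a * inner ℝ (D a) x ^ 2 = π a * inner ℝ (D a - μ) x ^ 2 +
      2 * inner ℝ μ x * (π a * inner ℝ (D a) x) - π a * inner ℝ μ x ^ 2 := by
    intro a
    rw [inner_sub_left]
    ring
  simp only [h, Finset.sum_sub_distrib, Finset.sum_add_distrib, ← Finset.mul_sum, ← Finset.sum_mul,
    hπ1, sum_mul_inner, hμ]
  nlinarith [sq_nonneg (inner ℝ μ x)]

theorem sum_sum_inner_sub_sq_le (hπ : ∀ a, 0 ≤ π a) (hπ1 : ∑ a, π a = 1) {D : W → H} {μ : H}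
    (hμ : ∑ a, π a • D a = μ) :
    ∑ a, π a * ∑ b, π b * inner ℝ (D b - μ) (D a - μ) ^ 2 ≤
      ∑ a, π a * ∑ b, π b * inner ℝ (D b) (D a) ^ 2 := by
  calc _ ≤ ∑ a, π a * ∑ b, π b * inner ℝ (D b) (D a - μ) ^ 2 :=
        Finset.sum_le_sum fun a _ =>
          mul_le_mul_of_nonneg_left (sum_inner_sub_sq_le hπ1 hμ _) (hπ a)
    _ = ∑ b, π b * ∑ a, π a * inner ℝ (D a - μ) (D b) ^ 2 := by
        simp only [Finset.mul_sum]
        rw [Finset.sum_comm]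
        refine Finset.sum_congr rfl fun b _ => Finset.sum_congr rfl fun a _ => ?_
        rw [real_inner_comm]
        ring
    _ ≤ ∑ b, π b * ∑ a, π a * inner ℝ (D a) (D b) ^ 2 :=
        Finset.sum_le_sum fun a _ =>
          mul_le_mul_of_nonneg_left (sum_inner_sub_sq_le hπ1 hμ _) (hπ a)

end Moments

/-! ### The `ℓ₂` tester -/

theorem count_ofFn {Y : Type} [DecidableEq Y] {n : ℕ} (v : Fin n → Y) (j : Y) :
    ((List.ofFn v).count j : ℝ) = ∑ i, if v i = j then 1 else 0 := by
  induction n with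
  | zero => simp
  | succ n ih =>
    rw [List.ofFn_succ, List.count_cons, Fin.sum_univ_succ, Nat.cast_add, ih]
    simp [add_comm]

theorem l2Statistic_perm {Y : Type} [Fintype Y] [DecidableEq Y] {u u' : List Y} (h : u.Perm u')
    (v : List Y) : l2Statistic u v = l2Statistic u' v := by
  simp only [l2Statistic, h.count_eq]

theorem l2Tester_perm {Y : Type} [Fintype Y] [DecidableEq Y] (q : PMF Y) (g : ℝ) (u u' : List Y)
    (h : u.Perm u') : l2Tester q g u = l2Tester q g u' := by
  have hl := h.length_eq
  simp only [l2Tester, l2Statistic_perm h]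
  rw [hl]

/-- The difference `e_u - e_v` of basis vectors for a pair `(u, v)` of a message and a reference
sample; the sum over all pairs is the vector of differences of counts. -/
def sampleDiff {Y : Type} [DecidableEq Y] (w : Y × Y) : EuclideanSpace ℝ Y :=
  EuclideanSpace.single w.1 1 - EuclideanSpace.single w.2 1

theorem sampleDiff_apply {Y : Type} [DecidableEq Y] (w : Y × Y) (j : Y) :
    sampleDiff w j = (if w.1 = j then 1 else 0) - (if w.2 = j then 1 else 0) := by
  simp [sampleDiff, eq_comm]

/-- A family of weights, as a point of Euclidean space. -/
abbrev weightVec {Y : Type} [Fintype Y] (q : Y → ℝ) : EuclideanSpace ℝ Y := WithLp.toLp 2 q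

theorem weightVec_apply {Y : Type} [Fintype Y] (q : Y → ℝ) (j : Y) : weightVec q j = q j := rfl

theorem norm_weightVec_le_one {Y : Type} [Fintype Y] {q : Y → ℝ} (hq0 : ∀ j, 0 ≤ q j)
    (hq : ∑ j, q j = 1) : ‖weightVec q‖ ≤ 1 := by
  have hq1 : ∀ j, q j ≤ 1 := fun j => by
    rw [← hq]; exact Finset.single_le_sum (fun i _ => hq0 i) (Finset.mem_univ j)
  have : ‖weightVec q‖ ^ 2 ≤ 1 := by
    rw [EuclideanSpace.real_norm_sq_eq, ← hq]
    refine Finset.sum_le_sum fun j _ => ?_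
    have := hq0 j
    rw [weightVec_apply]
    nlinarith [hq1 j]
  nlinarith [norm_nonneg (weightVec q)]

/-- The sum of the three bounds on the fluctuations of the statistic under the alternative; `M` is
the `ℓ₂` distance of the two distributions. -/
theorem soundness_arith {n β M : ℝ} (hn : 0 < n) (hβ : 0 < β) (hM : 0 < M)
    (h1 : 20000 * β ≤ n * M ^ 2) (h2 : 20000 * M ≤ n * M ^ 2) :
    (1 / (n ^ 2 * M ^ 2 / 8) ^ 2) * (8 * n ^ 2 * (2 * β + M) ^ 2) +
      ((2 * n / (n ^ 2 * M ^ 2 / 8)) ^ 2 * (n * (2 * (2 * β + M) * M ^ 2)) +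
        (2 / (n ^ 2 * M ^ 2 / 8)) * (n * β)) ≤ 1 / 3 := by
  have hnM : 0 < n * M ^ 2 := by positivity
  have hx : (2 * β + M) / (n * M ^ 2) ≤ 3 / 20000 := by
    rw [div_le_div_iff₀ hnM (by norm_num)]
    linarith
  have hy : β / (n * M ^ 2) ≤ 1 / 20000 := by
    rw [div_le_div_iff₀ hnM (by norm_num)]
    linarith
  have hP : 0 < 2 * β + M := by positivity
  set P := 2 * β + M with hPdef
  have hx0 : 0 ≤ P / (n * M ^ 2) := by positivity
  have e1 : (1 / (n ^ 2 * M ^ 2 / 8) ^ 2) * (8 * n ^ 2 * P ^ 2) = 512 * (P / (n * M ^ 2)) ^ 2 := by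
    field_simp
    norm_num
  have e2 : (2 * n / (n ^ 2 * M ^ 2 / 8)) ^ 2 * (n * (2 * P * M ^ 2)) =
      512 * (P / (n * M ^ 2)) := by
    field_simp
    norm_num
  have e3 : (2 / (n ^ 2 * M ^ 2 / 8)) * (n * β) = 16 * (β / (n * M ^ 2)) := by
    field_simp
    norm_num
  rw [e1, e2, e3]
  nlinarith

/-- Acceptance although the off-diagonal sum has mean `n (n - 1) M²` forces the
degenerate part `V`, the linear part `2 (n - 1) A` or the coincidences `2 B` to be at least
`n² M² / 8` in absolute value, since the constant is at least `7 n² M² / 8`. -/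
theorem accept_le {n V A B τ M : ℝ} (hn8 : 8 ≤ n) (hM : 0 < M) (hτ : 0 < τ) (hfar : τ ≤ M)
    (hB : 0 ≤ B) [Decidable (V + 2 * (n - 1) * A + n * (n - 1) * M ^ 2 - 2 * B ≤
      n ^ 2 * τ ^ 2 / 2)] :
    (if V + 2 * (n - 1) * A + n * (n - 1) * M ^ 2 - 2 * B ≤ n ^ 2 * τ ^ 2 / 2
      then (1 : ℝ) else 0) ≤
      (1 / (n ^ 2 * M ^ 2 / 8) ^ 2) * V ^ 2 +
        ((2 * n / (n ^ 2 * M ^ 2 / 8)) ^ 2 * A ^ 2 + (2 / (n ^ 2 * M ^ 2 / 8)) * B) := by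
  have hn0 : 0 < n := by linarith
  have hc : 0 < n ^ 2 * M ^ 2 / 8 := by positivity
  have g1 : n ^ 2 * τ ^ 2 / 2 ≤ 4 * (n ^ 2 * M ^ 2 / 8) := by
    have : n ^ 2 * τ ^ 2 ≤ n ^ 2 * M ^ 2 := by gcongr
    linarith
  have g2 : 7 * (n ^ 2 * M ^ 2 / 8) ≤ n * (n - 1) * M ^ 2 := by
    have : 0 ≤ n * M ^ 2 * (n - 8) := mul_nonneg (by positivity) (by linarith)
    nlinarith
  set c := n ^ 2 * M ^ 2 / 8 with hcdef
  have p1 : 0 ≤ (1 / c ^ 2) * V ^ 2 := by positivity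
  have p2 : 0 ≤ (2 * n / c) ^ 2 * A ^ 2 := by positivity
  have p3 : 0 ≤ (2 / c) * B := mul_nonneg (by positivity) hB
  split_ifs with h
  swap
  · positivity
  by_contra! hlt
  have e1 : V ^ 2 < c ^ 2 := by
    have : (1 / c ^ 2) * V ^ 2 < 1 := by linarith
    rwa [one_div_mul_eq_div, div_lt_one (by positivity)] at this
  have e2 : (2 * n * A) ^ 2 < c ^ 2 := by
    have : (2 * n / c) ^ 2 * A ^ 2 < 1 := by linarith
    rw [div_pow, div_mul_eq_mul_div, div_lt_one (by positivity)] at this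
    linarith
  have e3 : 2 * B < c := by
    have : (2 / c) * B < 1 := by linarith
    rwa [div_mul_eq_mul_div, div_lt_one hc] at this
  have f1 := (abs_lt_of_sq_lt_sq' e1 hc.le).1
  have f2 := (abs_lt_of_sq_lt_sq' e2 hc.le).1
  have f3 : -c ≤ 2 * (n - 1) * A := by
    rcases le_or_gt 0 A with hA0 | hA0
    · have : 0 ≤ (n - 1) * A := mul_nonneg (by linarith) hA0
      linarith
    · linarith
  linarith

section Tester

variable {Y : Type} [Fintype Y] [DecidableEq Y]

theorem inner_sampleDiff (w : Y × Y) (x : EuclideanSpace ℝ Y) :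
    inner ℝ (sampleDiff w) x = x w.1 - x w.2 := by
  simp [sampleDiff, inner_sub_left, EuclideanSpace.inner_single_left]

theorem norm_sampleDiff_sq (w : Y × Y) :
    ‖sampleDiff w‖ ^ 2 = 2 - 2 * if w.1 = w.2 then 1 else 0 := by
  rw [← real_inner_self_eq_norm_sq, inner_sampleDiff, sampleDiff_apply, sampleDiff_apply]
  by_cases h : w.1 = w.2
  · simp [h]
  · simp [h, Ne.symm h]; norm_num

/-- Pairing the `i`-th message with the `i`-th reference sample writes the statistic as an
off-diagonal sum minus twice the number of coincidences within the pairs. -/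
theorem l2Statistic_eq {n : ℕ} (w : Fin n → Y × Y) :
    l2Statistic (List.ofFn fun i => (w i).1) (List.ofFn fun i => (w i).2) =
      offDiagSum sampleDiff w - 2 * ∑ i, if (w i).1 = (w i).2 then 1 else 0 := by
  unfold l2Statistic offDiagSum
  rw [EuclideanSpace.real_norm_sq_eq]
  simp only [norm_sampleDiff_sq, count_ofFn, Finset.sum_sub_distrib]
  have h1 : ∀ j, (∑ i, sampleDiff (w i)) j =
      (∑ i, if (w i).1 = j then (1 : ℝ) else 0) - ∑ i, if (w i).2 = j then (1 : ℝ) else 0 := by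
    intro j
    rw [← Finset.sum_sub_distrib]
    simp [← sampleDiff_apply]
  have h2 : ∀ g : Fin n → Y, ∑ j, ∑ i, (if g i = j then (1 : ℝ) else 0) = n := by
    intro g
    rw [Finset.sum_comm]
    simp
  simp only [h1, h2, ← Finset.mul_sum]
  simp
  ring

theorem sum_sampleDiff {q r : Y → ℝ} (hq : ∑ j, q j = 1) (hr : ∑ j, r j = 1) :
    ∑ w : Y × Y, (q w.1 * r w.2) • sampleDiff w = weightVec q - weightVec r := by
  ext j
  simp only [WithLp.ofLp_sum, Finset.sum_apply, PiLp.smul_apply, PiLp.sub_apply, smul_eq_mul,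
    sampleDiff_apply, Fintype.sum_prod_type, mul_sub, Finset.sum_sub_distrib]
  have h1 : ∑ x, ∑ y, q x * r y * (if x = j then (1 : ℝ) else 0) = q j := by
    simp [← Finset.mul_sum, hr]
  have h2 : ∑ x, ∑ y, q x * r y * (if y = j then (1 : ℝ) else 0) = r j := by
    simp [← Finset.sum_mul, hq]
  rw [h1, h2]

theorem sum_inner_sampleDiff_sq_le {q r : Y → ℝ} (hq0 : ∀ j, 0 ≤ q j) (hr0 : ∀ j, 0 ≤ r j)
    (hq : ∑ j, q j = 1) (hr : ∑ j, r j = 1) (x : EuclideanSpace ℝ Y) :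
    ∑ w : Y × Y, (q w.1 * r w.2) * inner ℝ (sampleDiff w) x ^ 2 ≤
      2 * (‖weightVec q‖ + ‖weightVec r‖) * ‖x‖ ^ 2 := by
  have hle : ∀ g : Y → ℝ, ∑ j, g j * x j ^ 2 ≤ ‖weightVec g‖ * ‖x‖ ^ 2 := by
    intro g
    rw [EuclideanSpace.real_norm_sq_eq, Finset.mul_sum]
    refine Finset.sum_le_sum fun j _ => mul_le_mul_of_nonneg_right ?_ (sq_nonneg _)
    exact (le_abs_self _).trans (PiLp.norm_apply_le (weightVec g) j)
  calc _ ≤ ∑ w : Y × Y,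
        ((2 * (q w.1 * x w.1 ^ 2)) * r w.2 + q w.1 * (2 * (r w.2 * x w.2 ^ 2))) := by
        refine Finset.sum_le_sum fun w _ => ?_
        rw [inner_sampleDiff]
        nlinarith [mul_nonneg (mul_nonneg (hq0 w.1) (hr0 w.2)) (sq_nonneg (x w.1 + x w.2))]
    _ = 2 * ∑ j, q j * x j ^ 2 + 2 * ∑ j, r j * x j ^ 2 := by
        rw [Finset.sum_add_distrib, Fintype.sum_prod_type, Fintype.sum_prod_type]
        simp only [← Finset.mul_sum, ← Finset.sum_mul, hq, hr]
        ring
    _ ≤ _ := by linarith [hle q, hle r]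

theorem sum_sum_inner_sampleDiff_sq_le {q r : Y → ℝ} (hq0 : ∀ j, 0 ≤ q j) (hr0 : ∀ j, 0 ≤ r j)
    (hq : ∑ j, q j = 1) (hr : ∑ j, r j = 1) :
    ∑ a : Y × Y, (q a.1 * r a.2) * ∑ b : Y × Y, (q b.1 * r b.2) *
        inner ℝ (sampleDiff b) (sampleDiff a) ^ 2 ≤
      4 * (‖weightVec q‖ + ‖weightVec r‖) ^ 2 := by
  have hb : ∀ a : Y × Y, ∑ b : Y × Y, (q b.1 * r b.2) *
        inner ℝ (sampleDiff b) (sampleDiff a) ^ 2 ≤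
      4 * (q a.1 + r a.1 + q a.2 + r a.2) := by
    intro a
    calc _ ≤ ∑ b : Y × Y, 4 * (((q b.1 * if a.1 = b.1 then 1 else 0) * r b.2) +
          (q b.1 * (r b.2 * if a.1 = b.2 then 1 else 0)) +
          ((q b.1 * if a.2 = b.1 then 1 else 0) * r b.2) +
          (q b.1 * (r b.2 * if a.2 = b.2 then 1 else 0))) := by
          refine Finset.sum_le_sum fun b _ => ?_
          rw [inner_sampleDiff, sampleDiff_apply, sampleDiff_apply]
          have hp := mul_nonneg (hq0 b.1) (hr0 b.2)
          split_ifs <;> nlinarith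
      _ = _ := by
          rw [← Finset.mul_sum]
          simp only [Finset.sum_add_distrib, Fintype.sum_prod_type, mul_ite, mul_one, mul_zero,
            Finset.sum_ite_eq, Finset.mem_univ, if_true, ite_mul, zero_mul]
          simp [← Finset.mul_sum, ← Finset.sum_mul, hq, hr]
  have hqr : ∑ a : Y × Y, (q a.1 * r a.2) * (4 * (q a.1 + r a.1 + q a.2 + r a.2)) =
      4 * ‖weightVec q + weightVec r‖ ^ 2 := by
    rw [norm_add_sq_real, EuclideanSpace.real_norm_sq_eq, EuclideanSpace.real_norm_sq_eq]
    have e : ∀ a : Y × Y, (q a.1 * r a.2) * (4 * (q a.1 + r a.1 + q a.2 + r a.2)) =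
        4 * ((q a.1 ^ 2 * r a.2) + (q a.1 * r a.1) * r a.2 + q a.1 * (q a.2 * r a.2) +
          q a.1 * r a.2 ^ 2) := fun a => by ring
    simp only [e, ← Finset.mul_sum, Finset.sum_add_distrib, Fintype.sum_prod_type,
      ← Finset.sum_mul, hq, hr, PiLp.inner_apply]
    simp [mul_comm]
    ring
  calc _ ≤ ∑ a : Y × Y, (q a.1 * r a.2) * (4 * (q a.1 + r a.1 + q a.2 + r a.2)) :=
        Finset.sum_le_sum fun a _ =>
          mul_le_mul_of_nonneg_left (hb a) (mul_nonneg (hq0 _) (hr0 _))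
    _ = _ := hqr
    _ ≤ _ := by
        gcongr
        exact norm_add_le _ _

theorem iidMean_offDiagSum_sampleDiff_sq_le {q r : Y → ℝ} (hq0 : ∀ j, 0 ≤ q j)
    (hr0 : ∀ j, 0 ≤ r j) (hq : ∑ j, q j = 1) (hr : ∑ j, r j = 1) (n : ℕ) :
    iidMean (fun w : Y × Y => q w.1 * r w.2) n (fun w =>
        offDiagSum (fun a => sampleDiff a - (weightVec q - weightVec r)) w ^ 2) ≤
      8 * n ^ 2 * (‖weightVec q‖ + ‖weightVec r‖) ^ 2 := by
  have hπ1 : ∑ w : Y × Y, q w.1 * r w.2 = 1 := by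
    simp [Fintype.sum_prod_type, ← Finset.mul_sum, hq, hr]
  have hμ := sum_sampleDiff hq hr
  rw [iidMean_offDiagSum_sq hπ1 (by
    simp [smul_sub, Finset.sum_sub_distrib, hμ, ← Finset.sum_smul, hπ1])]
  have h1 := (sum_sum_inner_sub_sq_le (fun w : Y × Y => mul_nonneg (hq0 w.1) (hr0 w.2)) hπ1
    hμ).trans (sum_sum_inner_sampleDiff_sq_le hq0 hr0 hq hr)
  rcases Nat.eq_zero_or_pos n with rfl | hn
  · simp
  have hn1 : (1 : ℝ) ≤ n := by exact_mod_cast hn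
  calc _ ≤ 2 * (n : ℝ) * (n - 1) * (4 * (‖weightVec q‖ + ‖weightVec r‖) ^ 2) :=
        mul_le_mul_of_nonneg_left h1 (mul_nonneg (by positivity) (by linarith))
    _ ≤ _ := by
        have := mul_nonneg (Nat.cast_nonneg n : (0 : ℝ) ≤ n)
          (sq_nonneg (‖weightVec q‖ + ‖weightVec r‖))
        nlinarith

open Classical in
/-- Under the null hypothesis only the degenerate part of the statistic can be large, since the
coincidences lower it. -/
theorem l2Tester_completeness {r : Y → ℝ} (hr0 : ∀ j, 0 ≤ r j) (hr : ∑ j, r j = 1)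
    {β τ : ℝ} (hβ : ‖weightVec r‖ ≤ β) (hτ : 0 < τ) (hτβ : τ ≤ β) {n : ℕ}
    (hn : 20000 * β ≤ n * τ ^ 2) :
    iidMean (fun w : Y × Y => r w.1 * r w.2) n (fun w =>
      if offDiagSum sampleDiff w - 2 * ∑ i, (if (w i).1 = (w i).2 then (1 : ℝ) else 0) ≤
        (n : ℝ) ^ 2 * τ ^ 2 / 2 then 0 else 1) ≤ 1 / 3 := by
  have hβ0 : 0 < β := hτ.trans_le hτβ
  have hnτ : 0 < n * τ ^ 2 := lt_of_lt_of_le (by positivity) hn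
  have hn0 : (0 : ℝ) < n := pos_of_mul_pos_left hnτ (sq_nonneg τ)
  have h1 := iidMean_offDiagSum_sampleDiff_sq_le hr0 hr0 hr hr n
  simp only [sub_self, sub_zero] at h1
  have hc : 0 < (n : ℝ) ^ 2 * τ ^ 2 / 2 := by positivity
  calc _ ≤ iidMean (fun w : Y × Y => r w.1 * r w.2) n (fun w =>
        (1 / ((n : ℝ) ^ 2 * τ ^ 2 / 2) ^ 2) * offDiagSum sampleDiff w ^ 2) := by
        refine iidMean_mono (fun w => mul_nonneg (hr0 _) (hr0 _)) fun w => ?_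
        split_ifs with h
        · positivity
        · rw [one_div_mul_eq_div, one_le_div (by positivity)]
          have hB : (0 : ℝ) ≤ ∑ i, (if (w i).1 = (w i).2 then (1 : ℝ) else 0) :=
            Finset.sum_nonneg fun i _ => by split_ifs <;> simp
          exact pow_le_pow_left₀ hc.le (by linarith) 2
    _ ≤ (1 / ((n : ℝ) ^ 2 * τ ^ 2 / 2) ^ 2) * (8 * n ^ 2 * (β + β) ^ 2) := by
        rw [iidMean_const_mul]
        refine mul_le_mul_of_nonneg_left (h1.trans ?_) (by positivity)
        gcongr
    _ = 128 * (β / (n * τ ^ 2)) ^ 2 := by field_simp; ring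
    _ ≤ 128 * (1 / 20000) ^ 2 := by
        have : β / (n * τ ^ 2) ≤ 1 / 20000 := by
          rw [div_le_div_iff₀ hnτ (by norm_num)]
          linarith
        gcongr
    _ ≤ 1 / 3 := by norm_num

open Classical in
/-- Under the alternative the degenerate part, the linear part and the coincidences are all
unlikely to cancel the mean. -/
theorem l2Tester_soundness {q r : Y → ℝ} (hq0 : ∀ j, 0 ≤ q j) (hq : ∑ j, q j = 1)
    (hr0 : ∀ j, 0 ≤ r j) (hr : ∑ j, r j = 1)
    {β τ : ℝ} (hβ : ‖weightVec r‖ ≤ β) (hτ : 0 < τ) (hτβ : τ ≤ β) {n : ℕ}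
    (hn : 20000 * β ≤ n * τ ^ 2) (hfar : τ ≤ ‖weightVec q - weightVec r‖) :
    iidMean (fun w : Y × Y => q w.1 * r w.2) n (fun w =>
      if offDiagSum sampleDiff w - 2 * ∑ i, (if (w i).1 = (w i).2 then (1 : ℝ) else 0) ≤
        (n : ℝ) ^ 2 * τ ^ 2 / 2 then 1 else 0) ≤ 1 / 3 := by
  have hβ0 : 0 < β := hτ.trans_le hτβ
  have hnτ : 0 < n * τ ^ 2 := lt_of_lt_of_le (by positivity) hn
  have hn0 : (0 : ℝ) < n := pos_of_mul_pos_left hnτ (sq_nonneg τ)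
  set μ := weightVec q - weightVec r with hμdef
  set M := ‖μ‖ with hM
  have hM0 : 0 < M := hτ.trans_le hfar
  have hπ1 : ∑ w : Y × Y, q w.1 * r w.2 = 1 := by
    simp [Fintype.sum_prod_type, ← Finset.mul_sum, hq, hr]
  have hπ0 : ∀ w : Y × Y, 0 ≤ q w.1 * r w.2 := fun w => mul_nonneg (hq0 _) (hr0 _)
  have hμ : ∑ w : Y × Y, (q w.1 * r w.2) • sampleDiff w = μ := sum_sampleDiff hq hr
  have hq_le : ‖weightVec q‖ ≤ β + M := by
    calc ‖weightVec q‖ = ‖weightVec r + μ‖ := by rw [hμdef]; congr 1; abel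
      _ ≤ ‖weightVec r‖ + ‖μ‖ := norm_add_le _ _
      _ ≤ _ := by gcongr
  have hM2 : M ≤ 2 := by
    calc M ≤ ‖weightVec q‖ + ‖weightVec r‖ := norm_sub_le _ _
      _ ≤ 1 + 1 := add_le_add (norm_weightVec_le_one hq0 hq) (norm_weightVec_le_one hr0 hr)
      _ = 2 := by norm_num
  have hnM : 20000 * β ≤ n * M ^ 2 := hn.trans (by gcongr)
  -- `n τ² ≥ 20000 β` and `τ ≤ β` give `n τ ≥ 20000`
  have hnM1 : 20000 * M ≤ n * M ^ 2 := by
    have h1 : 20000 ≤ n * τ := by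
      refine le_of_mul_le_mul_right ?_ hτ
      nlinarith
    have h2 : n * τ ≤ n * M := by gcongr
    nlinarith
  have hn8 : (8 : ℝ) ≤ n := by
    have : 20000 ≤ n * M := by
      refine le_of_mul_le_mul_right ?_ hM0
      nlinarith
    nlinarith
  set V : (Fin n → Y × Y) → ℝ := fun w => offDiagSum (fun a => sampleDiff a - μ) w with hV
  set A : (Fin n → Y × Y) → ℝ := fun w => inner ℝ (∑ i, (sampleDiff (w i) - μ)) μ with hA
  set B : (Fin n → Y × Y) → ℝ := fun w =>
    ∑ i, (if (w i).1 = (w i).2 then (1 : ℝ) else 0) with hB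
  have hVm : iidMean (fun w : Y × Y => q w.1 * r w.2) n (fun w => V w ^ 2) ≤
      8 * n ^ 2 * (2 * β + M) ^ 2 := by
    refine (iidMean_offDiagSum_sampleDiff_sq_le hq0 hr0 hq hr n).trans ?_
    have : ‖weightVec q‖ + ‖weightVec r‖ ≤ 2 * β + M := by linarith
    gcongr
  have hAm : iidMean (fun w : Y × Y => q w.1 * r w.2) n (fun w => A w ^ 2) ≤
      n * (2 * (2 * β + M) * M ^ 2) := by
    simp only [hA]
    rw [iidMean_inner_sq (Z := fun a => sampleDiff a - μ) hπ1 (by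
      simp [smul_sub, Finset.sum_sub_distrib, hμ, ← Finset.sum_smul, hπ1])]
    refine mul_le_mul_of_nonneg_left ?_ hn0.le
    refine (sum_inner_sub_sq_le hπ1 hμ μ).trans
      ((sum_inner_sampleDiff_sq_le hq0 hr0 hq hr μ).trans ?_)
    have : ‖weightVec q‖ + ‖weightVec r‖ ≤ 2 * β + M := by linarith
    gcongr
  have hBm : iidMean (fun w : Y × Y => q w.1 * r w.2) n B ≤ n * β := by
    simp only [hB]
    rw [iidMean_sum_apply hπ1 (fun a : Y × Y => if a.1 = a.2 then (1 : ℝ) else 0)]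
    refine mul_le_mul_of_nonneg_left ?_ hn0.le
    calc _ = inner ℝ (weightVec q) (weightVec r) := by
          simp [Fintype.sum_prod_type, PiLp.inner_apply, mul_comm]
      _ ≤ ‖weightVec q‖ * ‖weightVec r‖ := real_inner_le_norm _ _
      _ ≤ 1 * β := mul_le_mul (norm_weightVec_le_one hq0 hq) hβ (norm_nonneg _) zero_le_one
      _ = β := one_mul β
  have hB0 : ∀ w, 0 ≤ B w := fun w => Finset.sum_nonneg fun i _ => by split_ifs <;> simp
  refine le_trans ?_ (soundness_arith hn0 hβ0 hM0 hnM hnM1)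
  calc _ ≤ iidMean (fun w : Y × Y => q w.1 * r w.2) n (fun w =>
        (1 / ((n : ℝ) ^ 2 * M ^ 2 / 8) ^ 2) * V w ^ 2 +
          ((2 * n / ((n : ℝ) ^ 2 * M ^ 2 / 8)) ^ 2 * A w ^ 2 +
            (2 / ((n : ℝ) ^ 2 * M ^ 2 / 8)) * B w)) := by
        refine iidMean_mono hπ0 fun w => ?_
        have h := accept_le (V := V w) (A := A w) hn8 hM0 hτ hfar (hB0 w)
        rw [← offDiagSum_eq_centered sampleDiff μ w] at h
        exact h
    _ ≤ _ := by
        rw [iidMean_add, iidMean_add, iidMean_const_mul, iidMean_const_mul, iidMean_const_mul]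
        have k1 : 0 ≤ 1 / ((n : ℝ) ^ 2 * M ^ 2 / 8) ^ 2 := by positivity
        have k2 : 0 ≤ (2 * n / ((n : ℝ) ^ 2 * M ^ 2 / 8)) ^ 2 := by positivity
        have k3 : 0 ≤ 2 / ((n : ℝ) ^ 2 * M ^ 2 / 8) := by positivity
        exact add_le_add (mul_le_mul_of_nonneg_left hVm k1)
          (add_le_add (mul_le_mul_of_nonneg_left hAm k2) (mul_le_mul_of_nonneg_left hBm k3))

end Tester

/-! ### Running the tester behind the shuffler -/

theorem l2Tester_eq {Y : Type} [Fintype Y] [DecidableEq Y] (r : PMF Y) (g : ℝ) (u : List Y) {n : ℕ}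
    (h : u.length = n) [∀ v : Fin n → Y,
      Decidable (l2Statistic u (List.ofFn v) ≤ (n : ℝ) ^ 2 * g / 2)] :
    l2Tester r g u = (iidSample r n).bind fun v =>
      PMF.pure (decide (l2Statistic u (List.ofFn v) ≤ (n : ℝ) ^ 2 * g / 2)) := by
  subst h
  simp only [l2Tester, PMF.map, Function.comp_def]
  congr!

open Classical in
/-- The shuffler does not affect the statistic, so the analyser sees `n` i.i.d. pairs of a message
and a reference sample. -/
theorem prob_run_l2Tester {X Y : Type} [Fintype X] [Fintype Y] [DecidableEq Y] (M : X → PMF Y)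
    (r : PMF Y) (g : ℝ) (p : PMF X) (n : ℕ) :
    prob ((iidSample p n).bind (ShuffleProtocol.run
      ⟨fun x => (M x).map fun y => [y], l2Tester r g⟩ n)) {true} =
    iidMean (fun w : Y × Y => ((p.bind M) w.1).toReal * (r w.2).toReal) n fun w =>
      if offDiagSum sampleDiff w - 2 * ∑ i, (if (w i).1 = (w i).2 then (1 : ℝ) else 0) ≤
        (n : ℝ) ^ 2 * g / 2 then 1 else 0 := by
  have hrun : ∀ x, ShuffleProtocol.run ⟨fun x => (M x).map fun y => [y], l2Tester r g⟩ n x =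
      (concatMessages (fun x => (M x).map fun y => [y]) n x).bind (l2Tester r g) := by
    intro x
    simp only [ShuffleProtocol.run, ShuffleProtocol.shuffled, PMF.bind_bind]
    congr 1
    funext l
    exact shuffle_bind_of_perm _ (l2Tester_perm r g) l
  rw [prob_iidSample_bind]
  simp only [hrun, prob_concatMessages_bind]
  have htest : ∀ v : Fin n → Y, prob (l2Tester r g (List.ofFn v)) {true} =
      ∑ w : Fin n → Y, (∏ i, (r (w i)).toReal) *
        if l2Statistic (List.ofFn v) (List.ofFn w) ≤ (n : ℝ) ^ 2 * g / 2 then 1 else 0 := by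
    intro v
    rw [l2Tester_eq r g (List.ofFn v) (List.length_ofFn (f := v)), prob_iidSample_bind]
    refine Finset.sum_congr rfl fun w _ => ?_
    rw [prob_pure]
    simp
  have hmix : ∀ v : Fin n → Y, ∑ x : Fin n → X, (∏ i, (p (x i)).toReal) *
      ∏ i, (M (x i) (v i)).toReal = ∏ i, ((p.bind M) (v i)).toReal := by
    intro v
    simp only [bind_toReal, Finset.prod_univ_sum, Fintype.piFinset_univ, Finset.prod_mul_distrib]
  calc _ = ∑ v : Fin n → Y, (∏ i, ((p.bind M) (v i)).toReal) *
        prob (l2Tester r g (List.ofFn v)) {true} := by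
        simp only [← hmix, Finset.mul_sum, Finset.sum_mul]
        rw [Finset.sum_comm]
        simp only [mul_assoc]
    _ = _ := by
        unfold iidMean
        rw [← (Equiv.arrowProdEquivProdArrow (Fin n) (fun _ => Y) (fun _ => Y)).symm.sum_comp,
          Fintype.sum_prod_type]
        refine Finset.sum_congr rfl fun v _ => ?_
        rw [htest, Finset.mul_sum]
        refine Finset.sum_congr rfl fun w _ => ?_
        have h := l2Statistic_eq ((Equiv.arrowProdEquivProdArrow (Fin n)
          (fun _ => Y) (fun _ => Y)).symm (v, w))
        beta_reduce
        rw [← h, Finset.prod_mul_distrib, ← mul_assoc]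
        rfl

theorem iidMean_one_sub {W : Type} [Fintype W] {π : W → ℝ} (hπ1 : ∑ a, π a = 1) {n : ℕ}
    (P : (Fin n → W) → Prop) [DecidablePred P] :
    iidMean π n (fun v => if P v then 1 else 0) =
      1 - iidMean π n (fun v => if P v then 0 else 1) := by
  rw [eq_sub_iff_add_eq, ← iidMean_add]
  refine Eq.trans ?_ (iidMean_const (n := n) hπ1 1)
  congr 1
  funext v
  split_ifs <;> simp

theorem run_l2Tester_accepts {X Y : Type} [Fintype X] [Fintype Y] [DecidableEq Y] (M : X → PMF Y)
    (r : PMF Y) (p : PMF X) (n : ℕ) (hr : p.bind M = r)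
    {β τ : ℝ} (hβ : ‖weightVec fun y => (r y).toReal‖ ≤ β) (hτ : 0 < τ) (hτβ : τ ≤ β)
    (hn : 20000 * β ≤ n * τ ^ 2) :
    2 / 3 ≤ prob ((iidSample p n).bind (ShuffleProtocol.run
      ⟨fun x => (M x).map fun y => [y], l2Tester r (τ ^ 2)⟩ n)) {true} := by
  classical
  rw [prob_run_l2Tester, hr, iidMean_one_sub]
  · have h := l2Tester_completeness (r := fun y => (r y).toReal) (fun _ => ENNReal.toReal_nonneg)
      (sum_toReal_eq_one r) hβ hτ hτβ hn
    linarith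
  · simp [Fintype.sum_prod_type, ← Finset.mul_sum, sum_toReal_eq_one]

theorem run_l2Tester_rejects {X Y : Type} [Fintype X] [Fintype Y] [DecidableEq Y] (M : X → PMF Y)
    (r : PMF Y) (p : PMF X) (n : ℕ)
    {β τ : ℝ} (hβ : ‖weightVec fun y => (r y).toReal‖ ≤ β) (hτ : 0 < τ) (hτβ : τ ≤ β)
    (hn : 20000 * β ≤ n * τ ^ 2)
    (hfar : τ ≤ ‖(weightVec fun y => ((p.bind M) y).toReal) - weightVec fun y => (r y).toReal‖) :
    2 / 3 ≤ prob ((iidSample p n).bind (ShuffleProtocol.run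
      ⟨fun x => (M x).map fun y => [y], l2Tester r (τ ^ 2)⟩ n)) {false} := by
  classical
  have h := l2Tester_soundness (q := fun y => ((p.bind M) y).toReal) (r := fun y => (r y).toReal)
    (fun _ => ENNReal.toReal_nonneg) (sum_toReal_eq_one _) (fun _ => ENNReal.toReal_nonneg)
    (sum_toReal_eq_one r) hβ hτ hτβ hn hfar
  rw [← prob_run_l2Tester] at h
  linarith [prob_true_add_prob_false ((iidSample p n).bind (ShuffleProtocol.run
      ⟨fun x => (M x).map fun y => [y], l2Tester r (τ ^ 2)⟩ n))]

/-! ### Generalised Hadamard Response -/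

theorem sylvester_row_orthogonal (t : ℕ) (i i' : Fin (2 ^ t)) :
    ∑ j, sylvester t i j * sylvester t i' j = if i = i' then 2 ^ t else 0 := by
  induction t with
  | zero =>
    have : i = i' := Fin.ext (by have := i.isLt; have := i'.isLt; simp at *)
    simp [sylvester, this]
  | succ t ih =>
    simp only [sylvester, Matrix.reindex_apply, Matrix.submatrix_apply, Matrix.kroneckerMap_apply]
    set e : Fin 2 × Fin (2 ^ t) ≃ Fin (2 ^ (t + 1)) :=
      finProdFinEquiv.trans (finCongr (pow_succ' 2 t).symm) with he
    obtain ⟨⟨p0, p1⟩, rfl⟩ := e.surjective i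
    obtain ⟨⟨q0, q1⟩, rfl⟩ := e.surjective i'
    rw [← e.sum_comp]
    simp only [Equiv.symm_apply_apply, Fintype.sum_prod_type, e.injective.eq_iff, Prod.mk.injEq]
    have key : ∀ a b : ℤ, ∑ x, a * sylvester t p1 x * (b * sylvester t q1 x) =
        a * b * if p1 = q1 then 2 ^ t else 0 := by
      intro a b
      rw [← ih, Finset.mul_sum]
      exact Finset.sum_congr rfl fun x _ => by ring
    simp only [key]
    by_cases h : p1 = q1
    · fin_cases p0 <;> fin_cases q0 <;> simp [h, pow_succ, mul_two]
    · simp [h]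

section GHR

variable {k : ℕ} [NeZero k] {ε : ℝ}

theorem ghrS_two_mul (k : ℕ) [NeZero k] (ε : ℝ) : 2 * ghrS k ε = 2 ^ ghrT k ε := by
  have h1 := ghr_one_lt k ε
  unfold ghrS ghrB
  cases h : ghrT k ε with
  | zero => simp [h] at h1
  | succ t => rw [pow_succ]; omega

theorem ghrK_eq (k : ℕ) [NeZero k] (ε : ℝ) : ghrK k ε = 2 * ghrA k ε * ghrS k ε := by
  rw [ghrK, ghrB, ← ghrS_two_mul]; ring

theorem ghrS_pos (k : ℕ) [NeZero k] (ε : ℝ) : 0 < ghrS k ε := by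
  have := ghrS_two_mul k ε
  have := ghr_one_lt k ε
  omega

theorem ghrA_pos (k : ℕ) (ε : ℝ) : 0 < ghrA k ε := by unfold ghrA; positivity

theorem le_ghrK (k : ℕ) [NeZero k] (ε : ℝ) : k ≤ ghrK k ε :=
  (ghr_le k ε).trans (Nat.mul_le_mul_left _ (Nat.sub_le _ _))

theorem ghrRow_injective : Function.Injective (ghrRow k ε) := by
  intro x x' h
  simp only [ghrRow, Prod.mk.injEq, Fin.mk.injEq, add_left_inj] at h
  apply Fin.ext
  rw [← Nat.div_add_mod (x : ℕ) (2 ^ ghrT k ε - 1), h.1, h.2, Nat.div_add_mod]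

/-- The real indicator of `C_x`. -/
def ghrInd (k : ℕ) [NeZero k] (ε : ℝ) (x : Fin k) (y : GHRMessage k ε) : ℝ :=
  if y ∈ ghrSet k ε x then 1 else 0

theorem ghrInd_eq (x : Fin k) (y : GHRMessage k ε) :
    ghrInd k ε x y = if (ghrRow k ε x).1 = y.1 then
      (1 + (sylvester (ghrT k ε) (ghrRow k ε x).2 y.2 : ℝ)) / 2 else 0 := by
  have hm : y ∈ ghrSet k ε x ↔ reducedHadamard (ghrA k ε) (ghrT k ε) (ghrRow k ε x) y = 1 := by
    simp [ghrSet]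
  simp only [ghrInd, hm, reducedHadamard]
  by_cases h : (ghrRow k ε x).1 = y.1
  · rcases sylvester_eq_or (ghrT k ε) (ghrRow k ε x).2 y.2 with h1 | h1 <;> simp [h, h1]
  · simp [h]

/-- The sizes of the pairwise intersections: `|C_x ∩ C_x'|` is `s` for `x = x'`, `s / 2` for
distinct `x`, `x'` in the same block row, and `0` otherwise. -/
theorem sum_ghrInd_mul (x x' : Fin k) :
    ∑ y, ghrInd k ε x y * ghrInd k ε x' y =
      ghrS k ε / 2 * ((if (ghrRow k ε x).1 = (ghrRow k ε x').1 then 1 else 0) +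
        if x = x' then 1 else 0) := by
  have hrow : ∀ x : Fin k, ∑ j, (sylvester (ghrT k ε) (ghrRow k ε x).2 j : ℝ) = 0 := by
    intro x
    have := sylvester_row_sum (ghrT k ε) (ghrRow k ε x).2 (by simp [ghrRow])
    exact_mod_cast this
  have horth : ∑ j, (sylvester (ghrT k ε) (ghrRow k ε x).2 j : ℝ) *
      sylvester (ghrT k ε) (ghrRow k ε x').2 j =
      if (ghrRow k ε x).2 = (ghrRow k ε x').2 then 2 ^ ghrT k ε else 0 := by
    have := sylvester_row_orthogonal (ghrT k ε) (ghrRow k ε x).2 (ghrRow k ε x').2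
    exact_mod_cast this
  have hS : (2 : ℝ) ^ ghrT k ε = 2 * ghrS k ε := by exact_mod_cast (ghrS_two_mul k ε).symm
  simp only [ghrInd_eq, Fintype.sum_prod_type]
  by_cases hb : (ghrRow k ε x).1 = (ghrRow k ε x').1
  · have hx : x = x' ↔ (ghrRow k ε x).2 = (ghrRow k ε x').2 :=
      ⟨fun h => by rw [h], fun h => ghrRow_injective (Prod.ext hb h)⟩
    rw [Finset.sum_eq_single (ghrRow k ε x').1]
    · simp only [hb, if_true]
      have e : ∀ j, (1 + (sylvester (ghrT k ε) (ghrRow k ε x).2 j : ℝ)) / 2 *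
          ((1 + (sylvester (ghrT k ε) (ghrRow k ε x').2 j : ℝ)) / 2) =
          (1 + sylvester (ghrT k ε) (ghrRow k ε x).2 j + sylvester (ghrT k ε) (ghrRow k ε x').2 j +
          (sylvester (ghrT k ε) (ghrRow k ε x).2 j : ℝ) *
            sylvester (ghrT k ε) (ghrRow k ε x').2 j) / 4 := fun j => by ring
      simp only [e, ← Finset.sum_div, Finset.sum_add_distrib, hrow, horth]
      simp only [hx, Finset.sum_const, Finset.card_univ, Fintype.card_fin, nsmul_eq_mul, mul_one]
      push_cast
      rw [hS]
      split_ifs <;> ring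
    · intro i _ hi
      simp [hb, Ne.symm hi]
    · simp
  · have hx : x ≠ x' := fun h => hb (by rw [h])
    simp only [hb, hx, if_false, add_zero, mul_zero]
    refine Finset.sum_eq_zero fun i _ => Finset.sum_eq_zero fun j _ => ?_
    by_cases h1 : (ghrRow k ε x).1 = i
    · rw [if_neg (fun h2 => hb (h1.trans h2.symm) : ¬ (ghrRow k ε x').1 = i), mul_zero]
    · simp [h1]

theorem sum_sq_eq_sum_sum {X Y : Type} [Fintype X] [Fintype Y] (d : X → ℝ) (c : X → Y → ℝ) :
    ∑ y, (∑ x, d x * c x y) ^ 2 = ∑ x, ∑ x', d x * d x' * ∑ y, c x y * c x' y := by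
  simp only [sq, Finset.sum_mul_sum]
  simp only [Finset.mul_sum]
  rw [Finset.sum_comm]
  refine Finset.sum_congr rfl fun x _ => ?_
  rw [Finset.sum_comm]
  exact Finset.sum_congr rfl fun x' _ => Finset.sum_congr rfl fun y _ => by ring

/-- The Gram matrix of the sets `C_x` as a quadratic form: `s / 2` times the squared sums over the
block rows plus `s / 2` times the sum of squares. -/
theorem sum_ghrInd_sq (d : Fin k → ℝ) :
    ∑ y, (∑ x, d x * ghrInd k ε x y) ^ 2 =
      ghrS k ε / 2 * (∑ i, (∑ x, d x * if (ghrRow k ε x).1 = i then 1 else 0) ^ 2 +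
        ∑ x, d x ^ 2) := by
  rw [sum_sq_eq_sum_sum, sum_sq_eq_sum_sum]
  simp only [sum_ghrInd_mul, mul_add, Finset.sum_add_distrib, Finset.mul_sum]
  congr 1
  · refine Finset.sum_congr rfl fun x _ => Finset.sum_congr rfl fun x' _ => ?_
    have : ∑ i, (if (ghrRow k ε x).1 = i then (1 : ℝ) else 0) *
        (if (ghrRow k ε x').1 = i then 1 else 0) =
        if (ghrRow k ε x).1 = (ghrRow k ε x').1 then 1 else 0 := by
      simp [eq_comm]
    rw [← Finset.mul_sum, ← Finset.mul_sum, this]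
    ring
  · refine Finset.sum_congr rfl fun x _ => ?_
    simp
    ring

theorem ghr_den_pos (hε : 0 < ε) :
    0 < (ghrS k ε : ℝ) * Real.exp ε + ghrK k ε - ghrS k ε := by
  have h1 : (0 : ℝ) < ghrS k ε := by exact_mod_cast ghrS_pos k ε
  have h2 := Real.add_one_lt_exp hε.ne'
  have h3 : (0 : ℝ) ≤ ghrK k ε := Nat.cast_nonneg _
  nlinarith

theorem ghrMechanism_toReal (hε : 0 < ε) (x : Fin k) (y : GHRMessage k ε) :
    (ghrMechanism k ε x y).toReal = ((Real.exp ε - 1) * ghrInd k ε x y + 1) /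
      (ghrS k ε * Real.exp ε + ghrK k ε - ghrS k ε) := by
  have h2 := Real.add_one_lt_exp hε.ne'
  rw [ghrMechanism, PMF.ofFintype_apply, ENNReal.toReal_ofReal]
  · rfl
  · refine div_nonneg ?_ (ghr_den_pos hε).le
    split_ifs <;> linarith

theorem ghrMechanism_ldp (hε : 0 < ε) (x x' : Fin k) (y : GHRMessage k ε) :
    (ghrMechanism k ε x y).toReal ≤ Real.exp ε * (ghrMechanism k ε x' y).toReal := by
  have h2 := Real.add_one_lt_exp hε.ne'
  rw [ghrMechanism_toReal hε, ghrMechanism_toReal hε, ← mul_div_assoc]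
  refine div_le_div_of_nonneg_right ?_ (ghr_den_pos hε).le
  unfold ghrInd
  split_ifs <;> nlinarith

theorem bind_ghrMechanism_toReal (hε : 0 < ε) (p : PMF (Fin k)) (y : GHRMessage k ε) :
    ((p.bind (ghrMechanism k ε)) y).toReal =
      ((Real.exp ε - 1) * ∑ x, (p x).toReal * ghrInd k ε x y + 1) /
        (ghrS k ε * Real.exp ε + ghrK k ε - ghrS k ε) := by
  rw [bind_toReal]
  simp only [ghrMechanism_toReal hε, ← mul_div_assoc, ← Finset.sum_div, mul_add, mul_one,
    Finset.sum_add_distrib, sum_toReal_eq_one, Finset.mul_sum]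
  congr 2
  exact Finset.sum_congr rfl fun x _ => by ring

theorem uniform_toReal (x : Fin k) : (PMF.uniformOfFintype (Fin k) x).toReal = 1 / k := by
  simp [PMF.uniformOfFintype_apply]

/-- A distribution far from uniform in total variation is far in `ℓ₂`. -/
theorem sum_sq_sub_uniform_ge {α : ℝ} (hα : 0 < α) (p : PMF (Fin k))
    (hp : α < tvDist p (PMF.uniformOfFintype (Fin k))) :
    4 * α ^ 2 / k ≤ ∑ x, ((p x).toReal - 1 / k) ^ 2 := by
  classical
  have hk : (0 : ℝ) < k := by exact_mod_cast Nat.pos_of_ne_zero (NeZero.ne k)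
  obtain ⟨S, hS⟩ := exists_lt_of_lt_ciSup hp
  set d : Fin k → ℝ := fun x => (p x).toReal - 1 / k with hd
  have hd0 : ∑ x, d x = 0 := by
    simp [hd, Finset.sum_sub_distrib, sum_toReal_eq_one, hk.ne']
  have h1 : prob p S - prob (PMF.uniformOfFintype (Fin k)) S =
      ∑ x, d x * if x ∈ S then 1 else 0 := by
    rw [prob_eq_sum, prob_eq_sum, ← Finset.sum_sub_distrib]
    refine Finset.sum_congr rfl fun x _ => ?_
    rw [uniform_toReal, hd]
    ring
  have h2 : ∑ x, (2 * (d x * if x ∈ S then 1 else 0) - d x) ≤ ∑ x, |d x| := by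
    refine Finset.sum_le_sum fun x _ => ?_
    split_ifs
    · linarith [le_abs_self (d x)]
    · linarith [neg_abs_le (d x)]
  rw [Finset.sum_sub_distrib, hd0, ← Finset.mul_sum, ← h1] at h2
  have h3 : (∑ x, |d x|) ^ 2 ≤ k * ∑ x, d x ^ 2 := by
    have := sq_sum_le_card_mul_sum_sq (s := (Finset.univ : Finset (Fin k))) (f := fun x => |d x|)
    simpa using this
  have h4 : (2 * α) ^ 2 ≤ (∑ x, |d x|) ^ 2 := by
    apply pow_le_pow_left₀ (by positivity)
    linarith
  rw [div_le_iff₀ hk]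
  linarith

theorem ghrGammaSq_eq_den (hε : 0 < ε) (α : ℝ) :
    ghrGammaSq k ε α = 2 * α ^ 2 * ghrS k ε / k *
      ((Real.exp ε - 1) / (ghrS k ε * Real.exp ε + ghrK k ε - ghrS k ε)) ^ 2 := by
  have h1 : (0 : ℝ) < ghrS k ε := by exact_mod_cast ghrS_pos k ε
  have hk : (0 : ℝ) < k := by exact_mod_cast Nat.pos_of_ne_zero (NeZero.ne k)
  have hD := ghr_den_pos (k := k) hε
  have e : Real.exp ε + (ghrK k ε : ℝ) / ghrS k ε - 1 =
      (ghrS k ε * Real.exp ε + ghrK k ε - ghrS k ε) / ghrS k ε := by field_simp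
  rw [ghrGammaSq, e]
  field_simp

/-- Inputs at total variation distance more than `α` from uniform give messages at squared `ℓ₂`
distance at least `ghrGammaSq k ε α` from the reference distribution. -/
theorem ghr_separation (hε : 0 < ε) {α : ℝ} (hα : 0 < α) (p : PMF (Fin k))
    (hp : α < tvDist p (PMF.uniformOfFintype (Fin k))) :
    ghrGammaSq k ε α ≤ ‖(weightVec fun y => ((p.bind (ghrMechanism k ε)) y).toReal) -
      weightVec fun y => (ghrReference k ε y).toReal‖ ^ 2 := by
  have h1 : (0 : ℝ) < ghrS k ε := by exact_mod_cast ghrS_pos k ε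
  rw [ghrGammaSq_eq_den hε, EuclideanSpace.real_norm_sq_eq]
  set D := (ghrS k ε : ℝ) * Real.exp ε + ghrK k ε - ghrS k ε with hD
  have e : ∀ y, ((weightVec fun y => ((p.bind (ghrMechanism k ε)) y).toReal) -
      weightVec fun y => (ghrReference k ε y).toReal) y ^ 2 =
      ((Real.exp ε - 1) / D) ^ 2 * (∑ x, ((p x).toReal - 1 / k) * ghrInd k ε x y) ^ 2 := by
    intro y
    rw [PiLp.sub_apply, weightVec_apply, weightVec_apply, ghrReference]
    rw [bind_ghrMechanism_toReal hε, bind_ghrMechanism_toReal hε]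
    simp only [sub_mul, Finset.sum_sub_distrib, uniform_toReal]
    ring
  rw [Finset.sum_congr rfl fun y _ => e y, ← Finset.mul_sum, sum_ghrInd_sq, mul_comm]
  refine mul_le_mul_of_nonneg_left ?_ (sq_nonneg _)
  have h2 := sum_sq_sub_uniform_ge hα p hp
  have h3 : 0 ≤ ∑ i, (∑ x, ((p x).toReal - 1 / k) *
      if (ghrRow k ε x).1 = i then (1 : ℝ) else 0) ^ 2 :=
    Finset.sum_nonneg fun i _ => sq_nonneg _
  calc 2 * α ^ 2 * ghrS k ε / k = ghrS k ε / 2 * (4 * α ^ 2 / k) := by ring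
    _ ≤ _ := by
        gcongr
        linarith

theorem card_ghrBlock_le (i : Fin (ghrA k ε)) :
    ∑ x, (if (ghrRow k ε x).1 = i then (1 : ℝ) else 0) ≤ 2 * ghrS k ε := by
  classical
  rw [Finset.sum_boole]
  have h : (Finset.univ.filter fun x => (ghrRow k ε x).1 = i).card ≤ 2 ^ ghrT k ε := by
    conv_rhs => rw [← Fintype.card_fin (2 ^ ghrT k ε)]
    rw [← Finset.card_univ]
    refine Finset.card_le_card_of_injOn (fun x => (ghrRow k ε x).2) (fun _ _ => Finset.mem_coe.2
      (Finset.mem_univ _)) ?_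
    intro x hx x' hx' h
    simp only [Finset.coe_filter, Finset.mem_univ, true_and, Set.mem_ofPred_eq] at hx hx'
    exact ghrRow_injective (Prod.ext (hx.trans hx'.symm) h)
  have h' := h.trans_eq (ghrS_two_mul k ε).symm
  exact_mod_cast h'

/-- The reference distribution is nearly flat: its squared `ℓ₂` norm is `O(1 / k)`. -/
theorem norm_ghrReference_sq_le (hε : 0 < ε) :
    ‖weightVec fun y => (ghrReference k ε y).toReal‖ ^ 2 ≤ 5 / k := by
  have hs : (1 : ℝ) ≤ ghrS k ε := by exact_mod_cast ghrS_pos k ε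
  have hk : (0 : ℝ) < k := by exact_mod_cast Nat.pos_of_ne_zero (NeZero.ne k)
  have hkK : (k : ℝ) ≤ ghrK k ε := by exact_mod_cast le_ghrK k ε
  have hE := Real.add_one_lt_exp hε.ne'
  have hD := ghr_den_pos (k := k) hε
  rw [EuclideanSpace.real_norm_sq_eq]
  set D := (ghrS k ε : ℝ) * Real.exp ε + ghrK k ε - ghrS k ε with hDdef
  have hN : ∑ y, (∑ x : Fin k, 1 / (k : ℝ) * ghrInd k ε x y) ^ 2 ≤ 3 / 2 * ghrS k ε ^ 2 / k := by
    rw [sum_ghrInd_sq]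
    have h1 : ∑ i, (∑ x : Fin k, 1 / (k : ℝ) * if (ghrRow k ε x).1 = i then 1 else 0) ^ 2 ≤
        2 * (ghrS k ε : ℝ) / k := by
      simp only [← Finset.mul_sum]
      calc _ ≤ ∑ i : Fin (ghrA k ε), (1 / (k : ℝ)) ^ 2 * (2 * ghrS k ε) *
            ∑ x : Fin k, (if (ghrRow k ε x).1 = i then (1 : ℝ) else 0) := by
            refine Finset.sum_le_sum fun i _ => ?_
            rw [mul_pow, mul_assoc, sq (∑ x : Fin k, _)]
            refine mul_le_mul_of_nonneg_left ?_ (sq_nonneg _)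
            exact mul_le_mul_of_nonneg_right (card_ghrBlock_le i)
              (Finset.sum_nonneg fun x _ => by split_ifs <;> simp)
        _ = 2 * (ghrS k ε : ℝ) / k := by
            rw [← Finset.mul_sum, Finset.sum_comm]
            simp
            field_simp
    have h2 : ∑ x : Fin k, (1 / (k : ℝ)) ^ 2 = 1 / (k : ℝ) := by
      simp
      field_simp
    rw [h2]
    calc _ ≤ (ghrS k ε : ℝ) / 2 * (2 * ghrS k ε / k + ghrS k ε / k) := by
          gcongr
      _ = _ := by ring
  have hy : ∀ y, (weightVec fun y => (ghrReference k ε y).toReal) y ^ 2 ≤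
      2 * ((Real.exp ε - 1) / D) ^ 2 * (∑ x : Fin k, 1 / (k : ℝ) * ghrInd k ε x y) ^ 2 +
        2 / D ^ 2 := by
    intro y
    rw [weightVec_apply, ghrReference, bind_ghrMechanism_toReal hε]
    simp only [uniform_toReal]
    rw [div_pow, div_pow, mul_div_assoc', div_mul_eq_mul_div, ← add_div]
    refine div_le_div_of_nonneg_right ?_ (sq_nonneg D)
    nlinarith [sq_nonneg ((Real.exp ε - 1) * (∑ x : Fin k, 1 / (k : ℝ) * ghrInd k ε x y) - 1)]
  have hcard : (Fintype.card (GHRMessage k ε) : ℝ) = ghrK k ε := by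
    simp [ghrK, ghrB]
  calc _ ≤ 2 * ((Real.exp ε - 1) / D) ^ 2 *
        ∑ y, (∑ x : Fin k, 1 / (k : ℝ) * ghrInd k ε x y) ^ 2 + ghrK k ε * (2 / D ^ 2) := by
        refine (Finset.sum_le_sum fun y _ => hy y).trans_eq ?_
        rw [Finset.sum_add_distrib, ← Finset.mul_sum, Finset.sum_const, Finset.card_univ,
          nsmul_eq_mul, hcard]
    _ ≤ 2 * ((Real.exp ε - 1) / D) ^ 2 * (3 / 2 * ghrS k ε ^ 2 / k) +
          ghrK k ε * (2 / D ^ 2) := by gcongr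
    _ = 3 / k * ((ghrS k ε * (Real.exp ε - 1)) / D) ^ 2 + 2 / ghrK k ε * (ghrK k ε / D) ^ 2 := by
        have : (0 : ℝ) < ghrK k ε := by linarith
        field_simp
    _ ≤ 3 / k * 1 ^ 2 + 2 / k * 1 ^ 2 := by
        have hE0 : 0 ≤ Real.exp ε - 1 := by linarith
        have a1 : (ghrS k ε * (Real.exp ε - 1)) / D ≤ 1 := by
          rw [div_le_one hD, hDdef]; linarith
        have a2 : ghrK k ε / D ≤ 1 := by
          rw [div_le_one hD, hDdef]; nlinarith
        gcongr
    _ = 5 / k := by ring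

end GHR

/-! ### The parameters of the mechanism -/

theorem one_le_min_exp {k : ℕ} [NeZero k] {ε : ℝ} (hε : 0 < ε) :
    1 ≤ min (Real.exp ε) (2 * (k : ℝ)) := by
  have hk : (1 : ℝ) ≤ k := by exact_mod_cast Nat.pos_of_ne_zero (NeZero.ne k)
  exact le_min (Real.one_le_exp hε.le) (by linarith)

theorem ghrA_le {k : ℕ} [NeZero k] {ε : ℝ} (hε : 0 < ε) :
    (ghrA k ε : ℝ) ≤ min (Real.exp ε) (2 * (k : ℝ)) := by
  have hm := one_le_min_exp (k := k) hε
  have h0 : 0 ≤ Real.logb 2 (min (Real.exp ε) (2 * k)) := Real.logb_nonneg (by norm_num) hm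
  have h := Nat.floor_le h0
  rw [Real.le_logb_iff_rpow_le (by norm_num) (by linarith), Real.rpow_natCast] at h
  unfold ghrA
  exact_mod_cast h

theorem lt_two_mul_ghrA {k : ℕ} [NeZero k] {ε : ℝ} (hε : 0 < ε) :
    min (Real.exp ε) (2 * (k : ℝ)) < 2 * ghrA k ε := by
  have hm := one_le_min_exp (k := k) hε
  have h := Nat.lt_floor_add_one (Real.logb 2 (min (Real.exp ε) (2 * k)))
  rw [← Nat.cast_add_one, Real.logb_lt_iff_lt_rpow (by norm_num) (by linarith),
    Real.rpow_natCast, pow_succ] at h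
  unfold ghrA
  push_cast
  linarith

theorem ghrS_lt (k : ℕ) [NeZero k] (ε : ℝ) : (ghrS k ε : ℝ) < k / ghrA k ε + 1 := by
  have ha : (0 : ℝ) < ghrA k ε := by exact_mod_cast ghrA_pos k ε
  have hx : (1 : ℝ) ≤ (k : ℝ) / ghrA k ε + 1 := le_add_of_nonneg_left (by positivity)
  have h := Nat.ceil_lt_add_one (Real.logb_nonneg (b := 2) (by norm_num) hx)
  rw [← sub_lt_iff_lt_add, Real.lt_logb_iff_rpow_lt (by norm_num) (by linarith),
    Real.rpow_sub (by norm_num), Real.rpow_natCast, Real.rpow_one] at h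
  have hS : (2 : ℝ) ^ ghrT k ε = 2 * ghrS k ε := by exact_mod_cast (ghrS_two_mul k ε).symm
  change (2 : ℝ) ^ ghrT k ε / 2 < _ at h
  rw [hS] at h
  linarith

theorem ghr_bits (k : ℕ) [NeZero k] {ε : ℝ} (hε : 0 < ε) :
    ∃ l : ℕ, (l : ℝ) ≤ Real.logb 2 k + 4 ∧ Fintype.card (GHRMessage k ε) ≤ 2 ^ l := by
  have hk : (1 : ℝ) ≤ k := by exact_mod_cast Nat.pos_of_ne_zero (NeZero.ne k)
  refine ⟨⌊Real.logb 2 (min (Real.exp ε) (2 * k))⌋₊ + ghrT k ε, ?_, ?_⟩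
  · have ha : (0 : ℝ) < ghrA k ε := by exact_mod_cast ghrA_pos k ε
    have h16 : Real.logb 2 k + 4 = Real.logb 2 (k * 2 ^ (4 : ℕ)) := by
      rw [Real.logb_mul (by linarith) (by norm_num), Real.logb_pow, Real.logb_self_eq_one
        (by norm_num)]
      norm_num
    rw [h16, Real.le_logb_iff_rpow_le (by norm_num) (by positivity), Real.rpow_natCast, pow_add]
    have hA : (2 : ℝ) ^ ⌊Real.logb 2 (min (Real.exp ε) (2 * k))⌋₊ = ghrA k ε := by
      unfold ghrA; push_cast; rfl
    have hS : (2 : ℝ) ^ ghrT k ε = 2 * ghrS k ε := by exact_mod_cast (ghrS_two_mul k ε).symm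
    rw [hA, hS]
    have h1 := (ghrA_le (k := k) hε).trans (min_le_right _ _)
    have h2 := mul_lt_mul_of_pos_left (ghrS_lt k ε) ha
    have h3 : (ghrA k ε : ℝ) * (k / ghrA k ε + 1) = k + ghrA k ε := by field_simp
    linarith
  · rw [Fintype.card_prod, Fintype.card_fin, Fintype.card_fin, ghrA, pow_add]

/-- The loss of `ℓ₂` distance in the mechanism: the first term is for `e^ε ≤ 2 k`, where `a` is
within a factor two of `e^ε`, and the second for `e^ε > 2 k`, where `s = 1`. -/
theorem ghr_noise_le {k : ℕ} [NeZero k] (hk2 : 2 ≤ k) {ε : ℝ} (hε : 0 < ε) :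
    ghrS k ε * (Real.exp ε + 2 * ghrA k ε - 1) ^ 2 ≤
      36 * k * Real.exp ε + 16 * (Real.exp ε - 1) ^ 2 := by
  have hk : (2 : ℝ) ≤ k := by exact_mod_cast hk2
  have ha : (0 : ℝ) < ghrA k ε := by exact_mod_cast ghrA_pos k ε
  have hE := Real.one_lt_exp_iff.2 hε
  have h1 := ghrA_le (k := k) hε
  have h2 := lt_two_mul_ghrA (k := k) hε
  have h3 := ghrS_lt k ε
  rcases le_or_gt (Real.exp ε) (2 * k) with hcase | hcase
  · rw [min_eq_left hcase] at h1 h2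
    have h4 : (ghrS k ε : ℝ) * Real.exp ε ≤ 4 * k := by
      have h5 : (k : ℝ) / ghrA k ε * Real.exp ε ≤ 2 * k := by
        rw [div_mul_eq_mul_div, div_le_iff₀ ha]
        nlinarith
      nlinarith
    calc (ghrS k ε : ℝ) * (Real.exp ε + 2 * ghrA k ε - 1) ^ 2
        ≤ ghrS k ε * (3 * Real.exp ε) ^ 2 := by
          gcongr
          · linarith
          · linarith
      _ = 9 * (ghrS k ε * Real.exp ε) * Real.exp ε := by ring
      _ ≤ 9 * (4 * k) * Real.exp ε := by gcongr
      _ ≤ _ := by nlinarith [sq_nonneg (Real.exp ε - 1)]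
  · rw [min_eq_right hcase.le] at h1 h2
    have hs : (ghrS k ε : ℝ) ≤ 1 := by
      have : (k : ℝ) / ghrA k ε < 1 := by
        rw [div_lt_one ha]; linarith
      have h6 : (ghrS k ε : ℝ) < 2 := by linarith
      have h7 : ghrS k ε < 2 := by exact_mod_cast h6
      exact_mod_cast Nat.lt_succ_iff.mp h7
    calc (ghrS k ε : ℝ) * (Real.exp ε + 2 * ghrA k ε - 1) ^ 2
        ≤ 1 * (4 * (Real.exp ε - 1)) ^ 2 := by
          gcongr
          · linarith
          · linarith
      _ = 16 * (Real.exp ε - 1) ^ 2 := by ring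
      _ ≤ _ := le_add_of_nonneg_left (by positivity)

theorem ghrGammaSq_eq (k : ℕ) [NeZero k] (ε α : ℝ) :
    ghrGammaSq k ε α = 2 * α ^ 2 / (ghrS k ε * k) *
      ((Real.exp ε - 1) / (Real.exp ε + 2 * ghrA k ε - 1)) ^ 2 := by
  have hs : (0 : ℝ) < ghrS k ε := by exact_mod_cast ghrS_pos k ε
  have h : (ghrK k ε : ℝ) / ghrS k ε = 2 * ghrA k ε := by
    rw [ghrK_eq]
    push_cast
    field_simp
  rw [ghrGammaSq, h]

theorem ghrGammaSq_pos (k : ℕ) [NeZero k] {ε α : ℝ} (hε : 0 < ε) (hα : 0 < α) :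
    0 < ghrGammaSq k ε α := by
  have hs : (0 : ℝ) < ghrS k ε := by exact_mod_cast ghrS_pos k ε
  have hk : (0 : ℝ) < k := by exact_mod_cast Nat.pos_of_ne_zero (NeZero.ne k)
  have ha : (0 : ℝ) < ghrA k ε := by exact_mod_cast ghrA_pos k ε
  have hE := Real.one_lt_exp_iff.2 hε
  rw [ghrGammaSq_eq]
  have h1 : 0 < Real.exp ε - 1 := by linarith
  have h2 : 0 < Real.exp ε + 2 * ghrA k ε - 1 := by linarith
  positivity

theorem ghrGammaSq_le (k : ℕ) [NeZero k] {ε α : ℝ} (hε : 0 < ε) (hα : 0 < α) (hα1 : α < 1) :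
    ghrGammaSq k ε α ≤ 5 / k := by
  have hs : (1 : ℝ) ≤ ghrS k ε := by exact_mod_cast ghrS_pos k ε
  have hk : (0 : ℝ) < k := by exact_mod_cast Nat.pos_of_ne_zero (NeZero.ne k)
  have ha : (0 : ℝ) < ghrA k ε := by exact_mod_cast ghrA_pos k ε
  have hE := Real.one_lt_exp_iff.2 hε
  rw [ghrGammaSq_eq]
  have h1 : 0 ≤ Real.exp ε - 1 := by linarith
  have h2 : 0 < Real.exp ε + 2 * ghrA k ε - 1 := by linarith
  have h3 : (Real.exp ε - 1) / (Real.exp ε + 2 * ghrA k ε - 1) ≤ 1 := by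
    rw [div_le_one h2]; linarith
  calc _ ≤ 5 * 1 ^ 2 / (1 * k) * ((1 : ℝ)) ^ 2 := by
        gcongr
        norm_num
    _ = 5 / k := by ring

/-! ### The local privacy parameter -/

/-- The dependence `e^(x/2) (e^x - 1) / (e^x + 1)` of the privacy amplification bound on the local
privacy parameter. -/
def ampFactor (x : ℝ) : ℝ := Real.exp (x / 2) * ((Real.exp x - 1) / (Real.exp x + 1))

theorem ampFactor_strictMonoOn : StrictMonoOn ampFactor (Set.Ici 0) := by
  intro x hx y hy hxy
  have hx0 : 0 ≤ x := hx
  have e1 : 1 ≤ Real.exp x := Real.one_le_exp hx0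
  have e2 : Real.exp x < Real.exp y := Real.exp_lt_exp.2 hxy
  have e3 : Real.exp (x / 2) < Real.exp (y / 2) := Real.exp_lt_exp.2 (by linarith)
  have h1 : (Real.exp x - 1) / (Real.exp x + 1) < (Real.exp y - 1) / (Real.exp y + 1) := by
    rw [div_lt_div_iff₀ (by linarith) (by linarith)]
    nlinarith
  exact mul_lt_mul'' e3 h1 (Real.exp_pos _).le (div_nonneg (by linarith) (by linarith))

theorem ampFactor_zero : ampFactor 0 = 0 := by simp [ampFactor]

theorem ampFactor_continuous : Continuous ampFactor := by
  unfold ampFactor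
  refine Continuous.mul (by fun_prop) (Continuous.div (by fun_prop) (by fun_prop) ?_)
  intro x
  have := Real.exp_pos x
  positivity

theorem exists_ampFactor_eq {T : ℝ} (hT : 0 < T) : ∃ x, 0 < x ∧ ampFactor x = T := by
  have hbig : T ≤ ampFactor (2 + 4 * T) := by
    have e1 : 3 ≤ Real.exp (2 + 4 * T) := by linarith [Real.add_one_le_exp (2 + 4 * T)]
    have e2 : 2 * T ≤ Real.exp ((2 + 4 * T) / 2) := by
      linarith [Real.add_one_le_exp ((2 + 4 * T) / 2)]
    have e3 : 1 / 2 ≤ (Real.exp (2 + 4 * T) - 1) / (Real.exp (2 + 4 * T) + 1) := by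
      rw [le_div_iff₀ (by linarith)]; linarith
    calc T = 2 * T * (1 / 2) := by ring
      _ ≤ _ := mul_le_mul e2 e3 (by norm_num) (Real.exp_pos _).le
  obtain ⟨x, hx, hxT⟩ := intermediate_value_Icc (by linarith : (0 : ℝ) ≤ 2 + 4 * T)
    ampFactor_continuous.continuousOn (show T ∈ Set.Icc (ampFactor 0) (ampFactor (2 + 4 * T)) from
      ⟨by rw [ampFactor_zero]; exact hT.le, hbig⟩)
  refine ⟨x, lt_of_le_of_ne hx.1 ?_, hxT⟩
  rintro rfl
  rw [ampFactor_zero] at hxT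
  exact hT.ne hxT

theorem isLocalParameter_iff {n : ℕ} {ε δ x : ℝ} :
    IsLocalParameter n ε δ x ↔
      0 < x ∧ Real.exp ε - 1 = 16 * ampFactor x * √(Real.log (4 / δ) / n) := by
  unfold IsLocalParameter
  refine and_congr_right fun hx => ?_
  have hE := Real.one_lt_exp_iff.2 hx
  have h0 : 0 ≤ 16 * ampFactor x * √(Real.log (4 / δ) / n) := by
    have : 0 ≤ (Real.exp x - 1) / (Real.exp x + 1) := div_nonneg (by linarith) (by linarith)
    unfold ampFactor
    positivity
  have e : 1 + 16 * Real.exp (x / 2) * ((Real.exp x - 1) / (Real.exp x + 1)) *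
      √(Real.log (4 / δ) / n) = 1 + 16 * ampFactor x * √(Real.log (4 / δ) / n) := by
    unfold ampFactor; ring
  rw [e]
  constructor
  · intro h
    rw [h, Real.exp_log (by linarith)]
    ring
  · intro h
    rw [← h, add_sub_cancel, Real.log_exp]

theorem existsUnique_isLocalParameter {n : ℕ} {ε δ : ℝ} (hn : 1 ≤ n) (hε : 0 < ε) (hδ : 0 < δ)
    (hδ1 : δ < 1) : ∃ εL, IsLocalParameter n ε δ εL ∧ ∀ x, IsLocalParameter n ε δ x → x = εL := by
  have hn0 : (0 : ℝ) < n := by exact_mod_cast hn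
  have hL : 0 < Real.log (4 / δ) := Real.log_pos (by rw [lt_div_iff₀ hδ]; linarith)
  have hs : 0 < √(Real.log (4 / δ) / n) := Real.sqrt_pos.2 (by positivity)
  have hE := Real.one_lt_exp_iff.2 hε
  obtain ⟨x, hx, hxT⟩ := exists_ampFactor_eq
    (show 0 < (Real.exp ε - 1) / (16 * √(Real.log (4 / δ) / n)) from
      div_pos (by linarith) (by positivity))
  refine ⟨x, isLocalParameter_iff.2 ⟨hx, ?_⟩, fun y hy => ?_⟩
  · rw [hxT]; field_simp
  · obtain ⟨hy0, hy1⟩ := isLocalParameter_iff.1 hy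
    refine ampFactor_strictMonoOn.injOn (Set.mem_Ici.2 hy0.le) (Set.mem_Ici.2 hx.le) ?_
    rw [hxT, hy1]
    field_simp

/-- The privacy amplification formula bounds the local noise level by `ε`. -/
theorem exp_div_sq_le {x ε A L : ℝ} (hx : 0 < x) (hε : 0 < ε) (hL : 0 ≤ L)
    (h : Real.exp ε - 1 = 16 * ampFactor x * √L) (hA : A = Real.exp x) :
    A * ε ^ 2 ≤ 256 * L * (A - 1) ^ 2 := by
  subst hA
  have hE := Real.one_lt_exp_iff.2 hx
  have h1 : ε ≤ 16 * ampFactor x * √L := by linarith [Real.add_one_le_exp ε]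
  have h2 : ε ^ 2 ≤ (16 * ampFactor x * √L) ^ 2 := pow_le_pow_left₀ hε.le h1 2
  have h3 : (16 * ampFactor x * √L) ^ 2 = 256 * L * (Real.exp x *
      ((Real.exp x - 1) / (Real.exp x + 1)) ^ 2) := by
    have : Real.exp (x / 2) ^ 2 = Real.exp x := by rw [← Real.exp_nat_mul]; congr 1; push_cast; ring
    unfold ampFactor
    rw [mul_pow, mul_pow, mul_pow, this, Real.sq_sqrt hL]
    ring
  have h4 : Real.exp x * (Real.exp x * ((Real.exp x - 1) / (Real.exp x + 1)) ^ 2) ≤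
      (Real.exp x - 1) ^ 2 := by
    rw [div_pow, mul_div_assoc', mul_div_assoc', div_le_iff₀ (by positivity)]
    nlinarith [mul_nonneg (sq_nonneg (Real.exp x - 1)) (by linarith : 0 ≤ Real.exp x)]
  calc Real.exp x * ε ^ 2 ≤ Real.exp x * (256 * L * (Real.exp x *
      ((Real.exp x - 1) / (Real.exp x + 1)) ^ 2)) := by rw [← h3]; gcongr
    _ = 256 * L * (Real.exp x * (Real.exp x *
      ((Real.exp x - 1) / (Real.exp x + 1)) ^ 2)) := by ring
    _ ≤ _ := by gcongr

/-! ### The shuffle protocol -/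

theorem ghrProtocol_isRobustlyShufflePrivate {k : ℕ} [NeZero k] {n : ℕ} {ε α δ εL γ : ℝ}
    (hn : 1 ≤ n) (hε : 0 < ε) (hε1 : ε ≤ 1) (hδ : 0 < δ) (hδ1 : δ < 1)
    (hL : IsLocalParameter n ε δ εL) :
    (ghrProtocol k εL α).IsRobustlyShufflePrivate n ε (4 * δ ^ γ) γ := by
  obtain ⟨hx, hE⟩ := isLocalParameter_iff.1 hL
  have hn0 : (0 : ℝ) < n := by exact_mod_cast hn
  have hlog : 0 < Real.log (4 / δ) := Real.log_pos (by rw [lt_div_iff₀ hδ]; linarith)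
  intro m hmn hγm x x' hxx S
  have hsq : √(Real.exp εL * (Real.log (4 / δ) / n)) =
      Real.exp (εL / 2) * √(Real.log (4 / δ) / n) := by
    rw [Real.sqrt_mul (Real.exp_pos _).le, Real.exp_half]
  have key := shuffle_amplification (ghrMechanism k εL) (u := Real.exp εL) (E := Real.exp ε)
    (L := Real.log (4 / δ) / n) (Real.one_lt_exp_iff.2 hx) (ghrMechanism_ldp hx) (by positivity)
    (Real.one_le_exp hε.le)
    ((Real.exp_le_exp.2 hε1).trans (by linarith [Real.exp_one_lt_d9]))
    (by rw [hE, hsq, ampFactor]; ring) m x x' hxx S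
  refine key.trans (add_le_add_right ?_ _)
  rw [Real.rpow_def_of_pos hδ]
  gcongr
  have h1 : γ ≤ m / n := by rw [le_div_iff₀ hn0]; exact hγm
  have h2 : Real.log (4 / δ) = Real.log 4 - Real.log δ := Real.log_div (by norm_num) hδ.ne'
  have h3 : Real.log δ < 0 := Real.log_neg hδ hδ1
  have h4 : 0 < Real.log 4 := Real.log_pos (by norm_num)
  have h5 : (m : ℝ) * (Real.log (4 / δ) / n) = m / n * Real.log (4 / δ) := by ring
  have h6 : 0 ≤ (m : ℝ) / n := by positivity
  rw [h5, h2]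
  nlinarith

theorem ghrProtocol_solvesUniformityTesting {k : ℕ} [NeZero k] {n : ℕ} {ε α δ εL : ℝ}
    (hk2 : 2 ≤ k) (hn : 1 ≤ n) (hε : 0 < ε) (hα : 0 < α) (hα1 : α < 1) (hδ : 0 < δ) (hδ1 : δ < 1)
    (hL : IsLocalParameter n ε δ εL)
    (hnC : 1000000 * ((k : ℝ) ^ (3 / 4 : ℝ) / (α * ε) * √(Real.log (4 / δ)) + √k / α ^ 2) ≤ n) :
    (ghrProtocol k εL α).SolvesUniformityTesting n α := by
  obtain ⟨hx, hE⟩ := isLocalParameter_iff.1 hL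
  have hn0 : (0 : ℝ) < n := by exact_mod_cast hn
  have hk : (0 : ℝ) < k := by exact_mod_cast (by omega : 0 < k)
  have hlog : 0 < Real.log (4 / δ) := Real.log_pos (by rw [lt_div_iff₀ hδ]; linarith)
  have hg0 := ghrGammaSq_pos k hx hα
  have hτ : 0 < √(ghrGammaSq k εL α) := Real.sqrt_pos.2 hg0
  have hτ2 : √(ghrGammaSq k εL α) ^ 2 = ghrGammaSq k εL α := Real.sq_sqrt hg0.le
  have hβ : ‖weightVec fun y => (ghrReference k εL y).toReal‖ ≤ √(5 / k) :=
    Real.le_sqrt_of_sq_le (norm_ghrReference_sq_le hx)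
  have hτβ : √(ghrGammaSq k εL α) ≤ √(5 / k) := Real.sqrt_le_sqrt (ghrGammaSq_le k hx hα hα1)
  have hsample : 20000 * √(5 / k) ≤ n * √(ghrGammaSq k εL α) ^ 2 := by
    rw [hτ2, ghrGammaSq_eq]
    have hs : (0 : ℝ) < ghrS k εL := by exact_mod_cast ghrS_pos k εL
    have ha : (0 : ℝ) < ghrA k εL := by exact_mod_cast ghrA_pos k εL
    have hA := Real.one_lt_exp_iff.2 hx
    have hnoise := ghr_noise_le hk2 hx
    have hamp := exp_div_sq_le hx hε (by positivity) hE rfl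
    set A := Real.exp εL with hAdef
    set r := √(k : ℝ) with hr
    have hr0 : 0 < r := Real.sqrt_pos.2 hk
    have hrk : r ^ 2 = k := Real.sq_sqrt hk.le
    set l := Real.log (4 / δ) with hl
    have hfirst : 0 ≤ (k : ℝ) ^ (3 / 4 : ℝ) / (α * ε) * √l := by positivity
    have hsecond : 0 ≤ r / α ^ 2 := by positivity
    have hn1 : 1000000 * (r / α ^ 2) ≤ n := by linarith
    have hn2 : 1000000 ^ 2 * (k * r * l / (α ^ 2 * ε ^ 2)) ≤ (n : ℝ) ^ 2 := by
      have h1 : (1000000 * ((k : ℝ) ^ (3 / 4 : ℝ) / (α * ε) * √l)) ^ 2 ≤ (n : ℝ) ^ 2 :=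
        pow_le_pow_left₀ (by positivity) (by linarith) 2
      have h2 : ((k : ℝ) ^ (3 / 4 : ℝ)) ^ 2 = k * r := by
        rw [← Real.rpow_natCast, ← Real.rpow_mul hk.le, hr, Real.sqrt_eq_rpow,
          ← Real.rpow_one_add' hk.le (by norm_num)]
        norm_num
      refine le_of_eq_of_le ?_ h1
      rw [mul_pow, mul_pow, div_pow, h2, Real.sq_sqrt hlog.le, mul_pow]
      ring
    -- the first term of the sample size controls the noise when `e^εL ≤ 2k`, the second otherwise
    have hn1' : 1000000 * r ≤ n * α ^ 2 := by
      have := mul_le_mul_of_nonneg_right hn1 (sq_nonneg α)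
      rwa [mul_assoc, div_mul_cancel₀ _ (by positivity)] at this
    have hn2' : 1000000 ^ 2 * (k * r * l) ≤ n ^ 2 * α ^ 2 * ε ^ 2 := by
      have := mul_le_mul_of_nonneg_right hn2 (by positivity : 0 ≤ α ^ 2 * ε ^ 2)
      rw [mul_assoc, div_mul_cancel₀ _ (by positivity)] at this
      linarith
    have hA1 : 0 < A - 1 := by linarith
    have hmain1 : 1000000 * r * (36 * k * A) ≤ n * α ^ 2 * (A - 1) ^ 2 := by
      have h1 : A * ε ^ 2 * n ≤ 256 * l * (A - 1) ^ 2 := by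
        have := mul_le_mul_of_nonneg_right hamp hn0.le
        have e : 256 * (l / n) * (A - 1) ^ 2 * n = 256 * l * (A - 1) ^ 2 := by field_simp
        linarith
      have h2 : 1000000 ^ 2 * (k * r) * (A * ε ^ 2 * n) ≤
          1000000 ^ 2 * (k * r) * (256 * l * (A - 1) ^ 2) := by gcongr
      have h3 : 1000000 ^ 2 * (k * r * l) * (256 * (A - 1) ^ 2) ≤
          n ^ 2 * α ^ 2 * ε ^ 2 * (256 * (A - 1) ^ 2) := by gcongr
      refine le_of_mul_le_mul_left ?_ (by positivity : 0 < ε ^ 2 * n)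
      have h4 : 0 ≤ k * r * (A * ε ^ 2 * n) := by positivity
      linarith
    have hmain2 : 1000000 * r * (16 * (A - 1) ^ 2) ≤ n * α ^ 2 * (16 * (A - 1) ^ 2) := by gcongr
    have hmain : 50000 * r * (ghrS k εL * (A + 2 * ghrA k εL - 1) ^ 2) ≤
        n * α ^ 2 * (A - 1) ^ 2 := by
      calc _ ≤ 50000 * r * (36 * k * A + 16 * (A - 1) ^ 2) := by gcongr
        _ ≤ _ := by
          have : 0 ≤ n * α ^ 2 * (A - 1) ^ 2 := by positivity
          linarith
    have h5 : √(5 / k) ≤ 3 / r := by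
      rw [Real.sqrt_div (by norm_num)]
      gcongr
      rw [Real.sqrt_le_left (by norm_num)]
      norm_num
    have hden : 0 < A + 2 * ghrA k εL - 1 := by linarith
    calc 20000 * √(5 / k) ≤ 20000 * (3 / r) := by gcongr
      _ ≤ _ := by
        rw [div_pow, ← hrk, mul_div_assoc', div_mul_div_comm, mul_div_assoc', div_le_div_iff₀ hr0
          (by positivity)]
        have h6 : 0 ≤ r * (n * α ^ 2 * (A - 1) ^ 2 -
            50000 * r * (ghrS k εL * (A + 2 * ghrA k εL - 1) ^ 2)) :=
          mul_nonneg hr0.le (by linarith)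
        have h7 : 0 ≤ r ^ 2 * (ghrS k εL * (A + 2 * ghrA k εL - 1) ^ 2) := by positivity
        nlinarith
  have hP : ghrProtocol k εL α = ⟨fun x => (ghrMechanism k εL x).map fun y => [y],
      l2Tester (ghrReference k εL) (√(ghrGammaSq k εL α) ^ 2)⟩ := by
    rw [hτ2]; rfl
  rw [hP]
  refine ⟨run_l2Tester_accepts _ _ _ _ rfl hβ hτ hτβ hsample, fun p hp => ?_⟩
  refine run_l2Tester_rejects _ _ _ _ hβ hτ hτβ hsample ?_
  exact Real.sqrt_le_iff.2 ⟨norm_nonneg _, ghr_separation hx hα p hp⟩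

theorem ghrProtocol_sendsOneMessage {k : ℕ} [NeZero k] {εL α : ℝ} {l : ℕ}
    (hl : Fintype.card (GHRMessage k εL) ≤ 2 ^ l) : (ghrProtocol k εL α).SendsOneMessage l := by
  refine ⟨fun x t ht => ?_, hl⟩
  simp only [ghrProtocol, PMF.support_map, Set.mem_image] at ht
  obtain ⟨y, _, rfl⟩ := ht
  rfl

end

theorem mainTheorem2 :
    ∃ C : ℝ, 0 < C ∧ ∀ (k : ℕ) [NeZero k] (n : ℕ) (ε α δ : ℝ),
      2 ≤ k → 1 ≤ n → 0 < ε → ε ≤ 1 → 0 < α → α < 1 → 0 < δ → δ < 1 →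
      ∃ εL : ℝ, IsLocalParameter n ε δ εL ∧ (∀ x : ℝ, IsLocalParameter n ε δ x → x = εL) ∧
        (∀ γ : ℝ, 0 < γ → γ ≤ 1 →
          (ghrProtocol k εL α).IsRobustlyShufflePrivate n ε (4 * δ ^ γ) γ) ∧
        (C * ((k : ℝ) ^ (3 / 4 : ℝ) / (α * ε) * Real.sqrt (Real.log (4 / δ)) +
            Real.sqrt k / α ^ 2) ≤ n →
          (ghrProtocol k εL α).SolvesUniformityTesting n α) ∧
        ∃ l : ℕ, (l : ℝ) ≤ Real.logb 2 k + 4 ∧ (ghrProtocol k εL α).SendsOneMessage l := by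
  refine ⟨1000000, by norm_num, fun k _ n ε α δ hk hn hε hε1 hα hα1 hδ hδ1 => ?_⟩
  obtain ⟨εL, hL, huniq⟩ := existsUnique_isLocalParameter hn hε hδ hδ1
  obtain ⟨l, hl, hcard⟩ := ghr_bits k hL.1
  exact ⟨εL, hL, huniq,
    fun γ _ _ => ghrProtocol_isRobustlyShufflePrivate hn hε hε1 hδ hδ1 hL,
    ghrProtocol_solvesUniformityTesting hk hn hε hα hα1 hδ hδ1 hL,
    l, hl, ghrProtocol_sendsOneMessage hcard⟩
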